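/- A hypergraph $G$ on a finite set $V$ is a set of subsets of $V$ (hyperedges), each of cardinality at least $2$. Let $H$ be the $\mathbb Q$-vector space with basis the isomorphism classes of hypergraphs on $[n]$, $n\ge 0$. It is a bialgebra with product induced by disjoint union (with shifted labels), unit the hypergraph on $[0]$, coproduct $\Delta(G)=\sum_{K\sqcup L=[n]}G|_K\otimes G|_L$, where $G|_K=\{U\in G: U\subseteq K\}$ is relabelled increasingly, and counit $1$ on the hypergraph on $[0]$ and $0$ on all other hypergraphs. Let $G$ be a hypergraph on $[n]$. For a set composition $A=(A_1,\dots,A_k)$ of $[n]$ put $G|_A=\bigcup_i G|_{A_i}$; the hypergraphs $G|_A$ are the flats of $G$. For a flat $F$, let $[n]/F$ be the quotient of $[n]$ by the equivalence relation generated by identifying the elements of each hyperedge of $F$ (its classes are the parts of the finest set composition $A$ with $G|_A=F$), and let $G/F$ be the hypergraph on $[n]/F$ whose hyperedges are the images with at least two elements of the hyperedges of $G$. An orientation $\mathcal O$ of a hypergraph splits each hyperedge $U$ into a nonempty head $\mathfrak a\subsetneq U$ and $\mathfrak b=U\setminus\mathfrak a$. For an orientation $\mathcal O$ of $G/F$,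 the oriented graph $(G/F)/\mathcal O$ is obtained by identifying the elements of each head and putting an arrow from $[\mathfrak a]$ to $[b]$ for every $b\in\mathfrak b$. Its vertices are regarded as the parts of a set partition $[n]/\mathcal O$ of $[n]$; $\mathcal O$ is acyclic if the oriented graph has no cycles (loops included). Let $\mathfrak O(G/F)$ be the set of acyclic orientations of $G/F$. For $\mathcal O\in\mathfrak O(G/F)$ let $\Psi(\mathcal O)=(A_1,\dots,A_k)$ be the list of the vertices of $(G/F)/\mathcal O$ in which $A_i$ is the source with the largest minimum among the sources of the graph restricted to the vertices other than $A_1,\dots,A_{i-1}$, and set $$a(G/F)=\sum_{\mathcal O\in\mathfrak O(G/F)}(-1)^{\ell(\Psi(\mathcal O))},$$ where $\ell(\Psi(\mathcal O))=k$ is the length of the list. Let $P_G=\sum_{U\in G}\mathrm{conv}\{e_i: i\in U\}\subset\mathbb R^n$ (Minkowski sum). A nonempty face $f$ of $P_G$ is indexed by $\mathcal O\in\mathfrak O(G/F)$ if its normal cone (the functionals that attain their maximum over $P_G$ at every point of $f$) is $$C_{\mathcal O}=\{x: x_a=x_b \text{ if } a,b \text{ lie in the same part of } [n]/\mathcal O;\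 x_a\ge x_b \text{ if } ([a],[b]) \text{ is an arrow of } (G/F)/\mathcal O\}.$$ **Statement.** $H$ has a unique antipode $S$, and for every $n\ge 0$ and every hypergraph $G$ on $[n]$, $$S(G)=\sum_{F\in \mathrm{Flats}(G)}a(G/F)\,F\quad\text{in } H.$$ Moreover, for every flat $F$ of $G$, each $\mathcal O\in\mathfrak O(G/F)$ indexes exactly one face of $P_G$, and $(-1)^n a(G/F)$ is the Euler characteristic of the union $X$ of the relatively open faces of $P_G$ indexed by the acyclic orientations of $G/F$, that is, $$(-1)^n a(G/F)=\sum_{f}(-1)^{\dim f},$$ where $f$ runs over the nonempty faces of $P_G$ whose relative interior is contained in $X$. -/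

import Mathlib

open scoped TensorProduct Pointwise

noncomputable section

/-- A (simple) hypergraph on the vertex set `V`: a finite collection of subsets of `V`,
each with at least two elements. -/
@[ext]
structure SimpleHypergraph (V : Type*) where
  edges : Finset (Finset V)
  two_le_card : ∀ U ∈ edges, 2 ≤ U.card

namespace SimpleHypergraph

theorem edges_injective {V : Type*} :
    Function.Injective (SimpleHypergraph.edges : SimpleHypergraph V → Finset (Finset V)) :=
  fun _ _ h => SimpleHypergraph.ext h

instance {V : Type*} [Finite V] : Finite (SimpleHypergraph V) :=
  Finite.of_injective _ edges_injective

instance {V : Type*} [Finite V] : Fintype (SimpleHypergraph V) := Fintype.ofFinite _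

/-- Pull a hypergraph back along an embedding: `W` is a hyperedge iff its image is one. For the
inclusion of `K` in `V` this is the restriction of `G` to `K`, the hyperedges contained in `K`. -/
def comap {V W : Type*} (f : V ↪ W) (G : SimpleHypergraph W) : SimpleHypergraph V where
  edges := G.edges.preimage (Finset.map f) (Finset.map_injective f).injOn
  two_le_card U hU := by
    have := G.two_le_card _ (Finset.mem_preimage.1 hU)
    rwa [Finset.card_map] at this

@[simp]
theorem mem_comap {V W : Type*} (f : V ↪ W) (G : SimpleHypergraph W) (U : Finset V) :
    U ∈ (G.comap f).edges ↔ U.map f ∈ G.edges := by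
  simp [comap, Finset.mem_preimage]

theorem comap_comap {V W X : Type*} (f : V ↪ W) (g : W ↪ X) (G : SimpleHypergraph X) :
    (G.comap g).comap f = G.comap (f.trans g) := by
  ext U; simp [Finset.map_map]

theorem comap_refl {V : Type*} (G : SimpleHypergraph V) :
    G.comap (Function.Embedding.refl V) = G := by
  ext U; simp

/-- Two hypergraphs are isomorphic if a bijection of the vertex sets carries the hyperedges of
one to the hyperedges of the other. -/
def Iso {V W : Type*} (G : SimpleHypergraph V) (G' : SimpleHypergraph W) : Prop :=
  ∃ σ : V ≃ W, ∀ U : Finset V, U ∈ G.edges ↔ U.map σ.toEmbedding ∈ G'.edges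

theorem iso_iff {V W : Type*} {G : SimpleHypergraph V} {G' : SimpleHypergraph W} :
    Iso G G' ↔ ∃ σ : V ≃ W, G = G'.comap σ.toEmbedding := by
  unfold Iso
  refine exists_congr fun σ => ⟨fun h => ?_, fun h U => ?_⟩
  · ext U; rw [mem_comap]; exact h U
  · rw [h, mem_comap]

theorem Iso.refl {V : Type*} (G : SimpleHypergraph V) : Iso G G :=
  ⟨Equiv.refl V, fun U => by simp⟩

theorem Iso.symm {V W : Type*} {G : SimpleHypergraph V} {G' : SimpleHypergraph W} (h : Iso G G') :
    Iso G' G := by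
  obtain ⟨σ, h⟩ := iso_iff.1 h
  refine iso_iff.2 ⟨σ.symm, ?_⟩
  rw [h, comap_comap]
  ext U; simp

theorem Iso.trans {V W X : Type*} {G : SimpleHypergraph V} {G' : SimpleHypergraph W} {G'' : SimpleHypergraph X}
    (h : Iso G G') (h' : Iso G' G'') : Iso G G'' := by
  obtain ⟨σ, rfl⟩ := iso_iff.1 h
  obtain ⟨τ, rfl⟩ := iso_iff.1 h'
  exact iso_iff.2 ⟨σ.trans τ, by rw [comap_comap]; rfl⟩

theorem comap_iso {V W : Type*} (σ : V ≃ W) (G : SimpleHypergraph W) :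
    Iso (G.comap σ.toEmbedding) G := iso_iff.2 ⟨σ, rfl⟩

/-- Disjoint union of hypergraphs. -/
def sum {V W : Type*} (G : SimpleHypergraph V) (G' : SimpleHypergraph W) : SimpleHypergraph (V ⊕ W) where
  edges := G.edges.map (Finset.mapEmbedding Function.Embedding.inl).toEmbedding |>.disjUnion
    (G'.edges.map (Finset.mapEmbedding Function.Embedding.inr).toEmbedding) (by
      rw [Finset.disjoint_left]
      intro U h h'
      obtain ⟨A, hA, rfl⟩ := Finset.mem_map.1 h
      obtain ⟨B, hB, hAB⟩ := Finset.mem_map.1 h'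
      obtain ⟨b, hb⟩ := Finset.card_pos.1 (lt_of_lt_of_le two_pos (G'.two_le_card B hB))
      have : (Sum.inr b : V ⊕ W) ∈ (Finset.mapEmbedding Function.Embedding.inl) A := by
        have h2 : (Sum.inr b : V ⊕ W) ∈ (Finset.mapEmbedding Function.Embedding.inr) B := by
          simpa [Finset.mapEmbedding_apply] using hb
        rw [← show _ = (Finset.mapEmbedding Function.Embedding.inl) A from hAB]
        exact h2
      simp [Finset.mapEmbedding_apply] at this)
  two_le_card U hU := by
    rw [Finset.mem_disjUnion] at hU
    rcases hU with h | h <;> obtain ⟨A, hA, rfl⟩ := Finset.mem_map.1 h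
    · simpa [Finset.mapEmbedding_apply] using G.two_le_card A hA
    · simpa [Finset.mapEmbedding_apply] using G'.two_le_card A hA

theorem mem_sum {V W : Type*} (G : SimpleHypergraph V) (G' : SimpleHypergraph W) (U : Finset (V ⊕ W)) :
    U ∈ (G.sum G').edges ↔ (∃ A ∈ G.edges, A.map Function.Embedding.inl = U) ∨
      ∃ B ∈ G'.edges, B.map Function.Embedding.inr = U := by
  simp [sum, Finset.mapEmbedding_apply]

theorem mem_sum' {V W : Type*} (G : SimpleHypergraph V) (G' : SimpleHypergraph W) (U : Finset (V ⊕ W)) :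
    U ∈ (G.sum G').edges ↔ (U.toRight = ∅ ∧ U.toLeft ∈ G.edges) ∨
      (U.toLeft = ∅ ∧ U.toRight ∈ G'.edges) := by
  rw [mem_sum]
  have e1 : ∀ A : Finset V, A.map Function.Embedding.inl = U ↔ U.toRight = ∅ ∧ A = U.toLeft := by
    intro A
    constructor
    · rintro rfl
      constructor <;> ext <;> simp
    · rintro ⟨h, rfl⟩
      ext (x | x)
      · simp
      · have : x ∉ U.toRight := by simp [h]
        simpa using this
  have e2 : ∀ A : Finset W, A.map Function.Embedding.inr = U ↔ U.toLeft = ∅ ∧ A = U.toRight := by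
    intro A
    constructor
    · rintro rfl
      constructor <;> ext <;> simp
    · rintro ⟨h, rfl⟩
      ext (x | x)
      · have : x ∉ U.toLeft := by simp [h]
        simpa using this
      · simp
  simp only [e1, e2]
  aesop

theorem sum_comap {V W V' W' : Type*} (f : V ↪ V') (g : W ↪ W') (G : SimpleHypergraph V')
    (G' : SimpleHypergraph W') :
    (G.comap f).sum (G'.comap g) = (G.sum G').comap (f.sumMap g) := by
  ext U
  rw [mem_comap, mem_sum', mem_sum', mem_comap, mem_comap]
  have e1 : (U.map (f.sumMap g)).toLeft = U.toLeft.map f := by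
    ext x; simp
  have e2 : (U.map (f.sumMap g)).toRight = U.toRight.map g := by
    ext x; simp
  rw [e1, e2, Finset.map_eq_empty, Finset.map_eq_empty]

theorem Iso.sum {V W V' W' : Type*} {G : SimpleHypergraph V} {G' : SimpleHypergraph V'} {K : SimpleHypergraph W}
    {K' : SimpleHypergraph W'} (h : Iso G G') (h' : Iso K K') : Iso (G.sum K) (G'.sum K') := by
  obtain ⟨σ, rfl⟩ := iso_iff.1 h
  obtain ⟨τ, rfl⟩ := iso_iff.1 h'
  refine iso_iff.2 ⟨Equiv.sumCongr σ τ, ?_⟩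
  rw [sum_comap]
  congr 1

theorem sum_comm_iso {V W : Type*} (G : SimpleHypergraph V) (K : SimpleHypergraph W) :
    Iso (G.sum K) (K.sum G) := by
  refine ⟨Equiv.sumComm V W, fun U => ?_⟩
  rw [mem_sum', mem_sum', or_comm]
  have e1 : (U.map (Equiv.sumComm V W).toEmbedding).toLeft = U.toRight := by ext x; simp
  have e2 : (U.map (Equiv.sumComm V W).toEmbedding).toRight = U.toLeft := by ext x; simp
  rw [e1, e2]

theorem eq_empty_iff_toLeft_toRight {A B : Type*} (S : Finset (A ⊕ B)) :
    S = ∅ ↔ S.toLeft = ∅ ∧ S.toRight = ∅ := by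
  constructor
  · rintro rfl
    constructor <;> ext <;> simp
  · rintro ⟨h1, h2⟩
    ext (x | x)
    · have : x ∉ S.toLeft := by simp [h1]
      simpa using this
    · have : x ∉ S.toRight := by simp [h2]
      simpa using this

theorem sum_assoc_iso {V W X : Type*} (G : SimpleHypergraph V) (K : SimpleHypergraph W) (L : SimpleHypergraph X) :
    Iso ((G.sum K).sum L) (G.sum (K.sum L)) := by
  refine ⟨Equiv.sumAssoc V W X, fun U => ?_⟩
  simp only [mem_sum']
  have e1 : (U.map (Equiv.sumAssoc V W X).toEmbedding).toLeft = U.toLeft.toLeft := by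
    ext x; simp
  have e2 : (U.map (Equiv.sumAssoc V W X).toEmbedding).toRight.toLeft = U.toLeft.toRight := by
    ext x; simp
  have e3 : (U.map (Equiv.sumAssoc V W X).toEmbedding).toRight.toRight = U.toRight := by
    ext x; simp
  have e5 := eq_empty_iff_toLeft_toRight (U.map (Equiv.sumAssoc V W X).toEmbedding).toRight
  have e6 := eq_empty_iff_toLeft_toRight U.toLeft
  rw [e1, e5, e2, e3, e6]
  tauto

/-- The product of `G ∈ HG[m]` and `G' ∈ HG[n]`: the union of `G` and of `G'` shifted by `m`,
a hypergraph on `m + n` vertices. -/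
def shiftUnion {m n : ℕ} (G : SimpleHypergraph (Fin m)) (G' : SimpleHypergraph (Fin n)) :
    SimpleHypergraph (Fin (m + n)) where
  edges := G.edges.image (fun U => U.map (Fin.castAddEmb n)) ∪
    G'.edges.image (fun U => U.map (Fin.natAddEmb m))
  two_le_card U hU := by
    rw [Finset.mem_union, Finset.mem_image, Finset.mem_image] at hU
    rcases hU with ⟨A, hA, rfl⟩ | ⟨A, hA, rfl⟩
    · simpa using G.two_le_card A hA
    · simpa using G'.two_le_card A hA

theorem shiftUnion_iso {m n : ℕ} (G : SimpleHypergraph (Fin m)) (G' : SimpleHypergraph (Fin n)) :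
    Iso (G.sum G') (G.shiftUnion G') := by
  refine ⟨finSumFinEquiv, fun U => ?_⟩
  rw [mem_sum]
  simp only [shiftUnion, Finset.mem_union, Finset.mem_image]
  have e1 : ∀ A : Finset (Fin m), A.map (Fin.castAddEmb n) =
      (A.map Function.Embedding.inl).map (finSumFinEquiv (m := m) (n := n)).toEmbedding := by
    intro A; rw [Finset.map_map]; congr 1
  have e2 : ∀ A : Finset (Fin n), A.map (Fin.natAddEmb m) =
      (A.map Function.Embedding.inr).map (finSumFinEquiv (m := m) (n := n)).toEmbedding := by
    intro A; rw [Finset.map_map]; congr 1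
  simp only [e1, e2, Finset.map_inj]

/-- The standardization `St(G|_K)` of the restriction of `G` to `K`: relabel the elements of `K`
by `0, …, |K| - 1` in increasing order. -/
def stRestrict {n : ℕ} (G : SimpleHypergraph (Fin n)) (K : Finset (Fin n)) :
    SimpleHypergraph (Fin K.card) :=
  G.comap (K.orderEmbOfFin rfl).toEmbedding

/-- Restriction of `G` to a subset of the vertices. -/
def restrict {V : Type*} (G : SimpleHypergraph V) (K : Finset V) : SimpleHypergraph {v // v ∈ K} :=
  G.comap (Function.Embedding.subtype fun v => v ∈ K)

theorem comap_iso_restrict {V W : Type*} (G : SimpleHypergraph W) (f : V ↪ W) (K : Finset W)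
    (h : ∀ w, w ∈ K ↔ ∃ v, f v = w) : Iso (G.comap f) (G.restrict K) := by
  refine iso_iff.2 ⟨Equiv.ofBijective (fun v => ⟨f v, (h _).2 ⟨v, rfl⟩⟩) ⟨?_, ?_⟩, ?_⟩
  · intro a b hab; exact f.injective (Subtype.ext_iff.1 hab)
  · rintro ⟨w, hw⟩
    obtain ⟨v, rfl⟩ := (h w).1 hw
    exact ⟨v, rfl⟩
  · rw [restrict, comap_comap]; rfl

theorem stRestrict_iso {n : ℕ} (G : SimpleHypergraph (Fin n)) (K : Finset (Fin n)) :
    Iso (G.stRestrict K) (G.restrict K) := by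
  refine comap_iso_restrict _ _ _ fun w => ?_
  have := Finset.range_orderEmbOfFin K rfl
  rw [Set.ext_iff] at this
  exact (this w).symm

theorem restrict_restrict_iso {V : Type*} (G : SimpleHypergraph V) (K : Finset V)
    (L : Finset {v // v ∈ K}) :
    Iso ((G.restrict K).restrict L) (G.restrict (L.map (Function.Embedding.subtype _))) := by
  rw [restrict, restrict, comap_comap]
  refine comap_iso_restrict _ _ _ fun w => ?_
  simp

theorem restrict_univ_iso {V : Type*} [Fintype V] (G : SimpleHypergraph V) :
    Iso (G.restrict Finset.univ) G := by
  have := comap_iso_restrict G (Function.Embedding.refl V) Finset.univ (by simp)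
  rw [comap_refl] at this
  exact this.symm

theorem Iso.restrict {V W : Type*} {G : SimpleHypergraph V} {G' : SimpleHypergraph W} (σ : V ≃ W)
    (h : G = G'.comap σ.toEmbedding) (K : Finset V) :
    Iso (G.restrict K) (G'.restrict (K.map σ.toEmbedding)) := by
  rw [h, SimpleHypergraph.restrict, comap_comap]
  refine comap_iso_restrict _ _ _ fun w => ?_
  rw [Finset.mem_map]
  simp

theorem sum_restrict_iso {V W : Type*} (G : SimpleHypergraph V) (G' : SimpleHypergraph W) (K : Finset V)
    (L : Finset W) :
    Iso ((G.restrict K).sum (G'.restrict L)) ((G.sum G').restrict (K.disjSum L)) := by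
  rw [restrict, restrict, sum_comap]
  refine comap_iso_restrict _ _ _ ?_
  rintro (w | w) <;> simp

/-- Isomorphism of hypergraphs on the vertex sets `Fin n`. -/
instance isoSetoid : Setoid (Σ n, SimpleHypergraph (Fin n)) where
  r G G' := Iso G.2 G'.2
  iseqv := ⟨fun _ => Iso.refl _, Iso.symm, Iso.trans⟩

end SimpleHypergraph

/-- Isomorphism classes of hypergraphs on `Fin n`, for all `n`. -/
def HypergraphClass : Type := Quotient SimpleHypergraph.isoSetoid

namespace HypergraphClass
open SimpleHypergraph

/-- The isomorphism class of a hypergraph on `Fin n`. -/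
def mk {n : ℕ} (G : SimpleHypergraph (Fin n)) : HypergraphClass := Quotient.mk _ ⟨n, G⟩

theorem mk_eq {m n : ℕ} {G : SimpleHypergraph (Fin m)} {G' : SimpleHypergraph (Fin n)} (h : Iso G G') :
    mk G = mk G' := Quotient.sound h

theorem ind {p : HypergraphClass → Prop} (h : ∀ (n : ℕ) (G : SimpleHypergraph (Fin n)), p (mk G))
    (c : HypergraphClass) : p c := Quotient.ind (fun G => h G.1 G.2) c

/-- The class of a hypergraph on an arbitrary finite vertex set. -/
def of {V : Type*} [Fintype V] (G : SimpleHypergraph V) : HypergraphClass :=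
  mk (G.comap (Fintype.equivFin V).symm.toEmbedding)

theorem of_eq {V W : Type*} [Fintype V] [Fintype W] {G : SimpleHypergraph V} {G' : SimpleHypergraph W}
    (h : Iso G G') : of G = of G' :=
  mk_eq ((comap_iso _ _).trans (h.trans (comap_iso _ _).symm))

theorem of_fin {n : ℕ} (G : SimpleHypergraph (Fin n)) : of G = mk G := mk_eq (comap_iso _ _)

/-- Number of vertices. -/
def size : HypergraphClass → ℕ :=
  Quotient.lift (fun G => G.1) (fun G G' h => by
    obtain ⟨σ, -⟩ := h
    simpa using Fintype.card_congr σ)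

theorem size_of {V : Type*} [Fintype V] (G : SimpleHypergraph V) : (of G).size = Fintype.card V := rfl

instance : Mul HypergraphClass where
  mul := Quotient.map₂ (fun G G' => ⟨G.1 + G'.1, G.2.shiftUnion G'.2⟩)
    (fun _ _ h _ _ h' => (shiftUnion_iso _ _).symm.trans ((h.sum h').trans (shiftUnion_iso _ _)))

theorem mk_mul_mk {m n : ℕ} (G : SimpleHypergraph (Fin m)) (G' : SimpleHypergraph (Fin n)) :
    mk G * mk G' = mk (G.shiftUnion G') := rfl

theorem of_mul_of {V W : Type*} [Fintype V] [Fintype W] (G : SimpleHypergraph V) (G' : SimpleHypergraph W) :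
    of G * of G' = of (G.sum G') := by
  rw [of, of, mk_mul_mk, ← of_fin]
  exact of_eq ((shiftUnion_iso _ _).symm.trans ((comap_iso _ _).sum (comap_iso _ _)))

instance : One HypergraphClass where
  one := mk (n := 0) ⟨∅, by simp⟩

theorem one_def : (1 : HypergraphClass) = mk (n := 0) ⟨∅, by simp⟩ := rfl

theorem one_eq_of {V : Type*} [Fintype V] [IsEmpty V] (G : SimpleHypergraph V) : 1 = of G := by
  rw [one_def, ← of_fin]
  refine of_eq ⟨Equiv.equivOfIsEmpty _ _, fun U => ?_⟩
  refine iff_of_false (by simp) fun h => ?_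
  have := G.two_le_card _ h
  rw [Finset.eq_empty_of_isEmpty (Finset.map _ U)] at this
  simp at this

instance : CommMonoid HypergraphClass where
  mul_assoc a b c := by
    induction a using ind with | h m G
    induction b using ind with | h n K
    induction c using ind with | h k L
    rw [← of_fin, ← of_fin, ← of_fin, of_mul_of, of_mul_of, of_mul_of, of_mul_of]
    exact of_eq (sum_assoc_iso _ _ _)
  mul_comm a b := by
    induction a using ind with | h m G
    induction b using ind with | h n K
    rw [← of_fin, ← of_fin, of_mul_of, of_mul_of]
    exact of_eq (sum_comm_iso _ _)
  one_mul a := by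
    induction a using ind with | h m G
    rw [one_def, ← of_fin, ← of_fin, of_mul_of]
    refine of_eq (Iso.symm ⟨(Equiv.emptySum (Fin 0) (Fin m)).symm, fun U => ?_⟩)
    rw [mem_sum']
    have e1 : (U.map (Equiv.emptySum (Fin 0) (Fin m)).symm.toEmbedding).toRight = U := by
      ext x; simp
    rw [e1]
    simp [Finset.eq_empty_of_isEmpty]
  mul_one a := by
    induction a using ind with | h m G
    rw [one_def, ← of_fin, ← of_fin, of_mul_of]
    refine of_eq (Iso.symm ⟨(Equiv.sumEmpty (Fin m) (Fin 0)).symm, fun U => ?_⟩)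
    rw [mem_sum']
    have e1 : (U.map (Equiv.sumEmpty (Fin m) (Fin 0)).symm.toEmbedding).toLeft = U := by
      ext x; simp
    rw [e1]
    simp [Finset.eq_empty_of_isEmpty]

theorem size_mul (a b : HypergraphClass) : (a * b).size = a.size + b.size := by
  induction a using ind with | h m G
  induction b using ind with | h n K
  rfl

theorem size_one : (1 : HypergraphClass).size = 0 := rfl

end HypergraphClass

/-- The vector space `H`: formal `ℚ`-linear combinations of isomorphism classes of hypergraphs,
with the product extending the product of isomorphism classes bilinearly. -/
def HypergraphAlgebra : Type := MonoidAlgebra ℚ HypergraphClass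

namespace HypergraphAlgebra
open SimpleHypergraph

instance : CommRing HypergraphAlgebra := inferInstanceAs (CommRing (MonoidAlgebra ℚ HypergraphClass))

instance : Algebra ℚ HypergraphAlgebra :=
  inferInstanceAs (Algebra ℚ (MonoidAlgebra ℚ HypergraphClass))

/-- The basis vector of an isomorphism class. -/
def basisVec : HypergraphClass →* HypergraphAlgebra := MonoidAlgebra.of ℚ HypergraphClass

/-- The class in `H` of a hypergraph on `Fin n`. -/
def cls {n : ℕ} (G : SimpleHypergraph (Fin n)) : HypergraphAlgebra :=
  basisVec (HypergraphClass.mk G)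

/-- Linear extension of a multiplicative map on isomorphism classes. -/
def lift {A : Type*} [CommRing A] [Algebra ℚ A] (f : HypergraphClass →* A) :
    HypergraphAlgebra →ₐ[ℚ] A := MonoidAlgebra.lift ℚ A HypergraphClass f

theorem lift_basisVec {A : Type*} [CommRing A] [Algebra ℚ A] (f : HypergraphClass →* A)
    (c : HypergraphClass) : lift f (basisVec c) = f c :=
  MonoidAlgebra.lift_of f c

theorem algHom_ext {A : Type*} [CommRing A] [Algebra ℚ A] {f g : HypergraphAlgebra →ₐ[ℚ] A}
    (h : ∀ {n : ℕ} (G : SimpleHypergraph (Fin n)),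
      f (basisVec (HypergraphClass.of G)) = g (basisVec (HypergraphClass.of G))) : f = g := by
  refine MonoidAlgebra.algHom_ext (R := ℚ) (A := ℚ) (M := HypergraphClass) (B := A)
    (fun c => ?_) (Subsingleton.elim _ _)
  induction c using HypergraphClass.ind with | h n G
  have := h G
  rw [HypergraphClass.of_fin] at this
  exact this

/-- The class in `H` of the restriction of `G` to `K`. -/
def res {V : Type*} (G : SimpleHypergraph V) (K : Finset V) : HypergraphAlgebra :=
  basisVec (HypergraphClass.of (G.restrict K))

theorem res_eq {V W : Type*} {G : SimpleHypergraph V} {G' : SimpleHypergraph W} {K : Finset V}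
    {K' : Finset W} (h : Iso (G.restrict K) (G'.restrict K')) : res G K = res G' K' :=
  congrArg basisVec (HypergraphClass.of_eq h)

theorem res_univ {V : Type*} [Fintype V] (G : SimpleHypergraph V) :
    res G Finset.univ = basisVec (HypergraphClass.of G) :=
  congrArg basisVec (HypergraphClass.of_eq (restrict_univ_iso G))

theorem res_empty {V : Type*} (G : SimpleHypergraph V) : res G ∅ = 1 := by
  rw [res, ← HypergraphClass.one_eq_of, map_one]

theorem cls_stRestrict {n : ℕ} (G : SimpleHypergraph (Fin n)) (K : Finset (Fin n)) :
    cls (G.stRestrict K) = res G K := by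
  rw [cls, ← HypergraphClass.of_fin, res, HypergraphClass.of_eq (stRestrict_iso G K)]

theorem sum_compl_equiv {V W : Type*} [Fintype V] [Fintype W] [DecidableEq V] [DecidableEq W]
    {A : Type*} [AddCommMonoid A] (σ : V ≃ W) (f : Finset W → Finset W → A) :
    ∑ K : Finset V, f (K.map σ.toEmbedding) (Kᶜ.map σ.toEmbedding) = ∑ K : Finset W, f K Kᶜ := by
  refine Fintype.sum_equiv σ.finsetCongr _ _ fun K => ?_
  congr 1
  ext w
  simp

theorem sum_restrict_congr {V W : Type*} [Fintype V] [Fintype W] [DecidableEq V] [DecidableEq W]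
    {G : SimpleHypergraph V} {G' : SimpleHypergraph W} (h : Iso G G') :
    ∑ K : Finset V, res G K ⊗ₜ[ℚ] res G Kᶜ = ∑ K : Finset W, res G' K ⊗ₜ[ℚ] res G' Kᶜ := by
  obtain ⟨σ, h⟩ := iso_iff.1 h
  rw [← sum_compl_equiv σ fun K L => res G' K ⊗ₜ[ℚ] res G' L]
  refine Finset.sum_congr rfl fun K _ => ?_
  rw [res_eq (Iso.restrict σ h K), res_eq (Iso.restrict σ h Kᶜ)]

/-- The coproduct of the class of `G`:
the sum of `St(G|_K) ⊗ St(G|_L)` over the decompositions of the vertex set into `K` and `L`. -/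
def comulClass : HypergraphClass → HypergraphAlgebra ⊗[ℚ] HypergraphAlgebra :=
  Quotient.lift
    (fun G => ∑ K : Finset (Fin G.1), cls (G.2.stRestrict K) ⊗ₜ[ℚ] cls (G.2.stRestrict Kᶜ))
    (fun G G' h => by
      simp only [cls_stRestrict]
      exact sum_restrict_congr h)

theorem comulClass_of {V : Type*} [Fintype V] [DecidableEq V] (G : SimpleHypergraph V) :
    comulClass (HypergraphClass.of G) = ∑ K : Finset V, res G K ⊗ₜ[ℚ] res G Kᶜ := by
  rw [← sum_restrict_congr (comap_iso (Fintype.equivFin V).symm G)]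
  refine Finset.sum_congr rfl fun K _ => ?_
  rw [← cls_stRestrict, ← cls_stRestrict]

theorem comulClass_one : comulClass 1 = 1 := by
  rw [HypergraphClass.one_def, ← HypergraphClass.of_fin, comulClass_of]
  rw [Fintype.sum_unique]
  rw [Algebra.TensorProduct.one_def]
  rw [Finset.eq_empty_of_isEmpty (default : Finset (Fin 0))ᶜ,
    Finset.eq_empty_of_isEmpty (default : Finset (Fin 0)), res_empty]

theorem comulClass_mul (a b : HypergraphClass) :
    comulClass (a * b) = comulClass a * comulClass b := by
  induction a using HypergraphClass.ind with | h m G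
  induction b using HypergraphClass.ind with | h n G'
  rw [← HypergraphClass.of_fin, ← HypergraphClass.of_fin, HypergraphClass.of_mul_of,
    comulClass_of, comulClass_of, comulClass_of, Finset.sum_mul_sum, ← Fintype.sum_prod_type']
  refine Fintype.sum_equiv Finset.sumEquiv.toEquiv _ _ fun K => ?_
  have key : ∀ (A : Finset (Fin m)) (B : Finset (Fin n)),
      res (G.sum G') (A.disjSum B) = res G A * res G' B := by
    intro A B
    rw [res, res, res, ← map_mul, HypergraphClass.of_mul_of,
      HypergraphClass.of_eq (sum_restrict_iso G G' A B)]
  have h1 : K = K.toLeft.disjSum K.toRight := by ext (x | x) <;> simp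
  have h2 : Kᶜ = (K.toLeftᶜ).disjSum (K.toRightᶜ) := by ext (x | x) <;> simp
  have h3 : res (G.sum G') K = res G K.toLeft * res G' K.toRight := by
    rw [← key, ← h1]
  have h4 : Finset.sumEquiv.toEquiv K = (K.toLeft, K.toRight) := rfl
  rw [h2, key, h3, h4]
  dsimp only
  rw [Algebra.TensorProduct.tmul_mul_tmul]

/-- The counit: `1` on the hypergraph without vertices, `0` on all others. -/
def counitClass (c : HypergraphClass) : ℚ := if c.size = 0 then 1 else 0

def comulHom : HypergraphAlgebra →ₐ[ℚ] HypergraphAlgebra ⊗[ℚ] HypergraphAlgebra :=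
  lift ⟨⟨comulClass, comulClass_one⟩, comulClass_mul⟩

def counitHom : HypergraphAlgebra →ₐ[ℚ] ℚ :=
  lift ⟨⟨counitClass, by simp [counitClass, HypergraphClass.size_one]⟩, fun a b => by
    simp only [counitClass, HypergraphClass.size_mul]
    split_ifs <;> first | omega | simp⟩

theorem comulHom_basisVec (c : HypergraphClass) : comulHom (basisVec c) = comulClass c :=
  lift_basisVec _ _

theorem counitHom_basisVec (c : HypergraphClass) : counitHom (basisVec c) = counitClass c :=
  lift_basisVec _ _

theorem counitHom_res {V : Type*} [DecidableEq V] (G : SimpleHypergraph V) (K : Finset V) :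
    counitHom (res G K) = if K = ∅ then 1 else 0 := by
  rw [res, counitHom_basisVec, counitClass, HypergraphClass.size_of]
  simp

theorem comulHom_res {V : Type*} [Fintype V] [DecidableEq V] (G : SimpleHypergraph V)
    (K : Finset V) :
    comulHom (res G K) = ∑ L ∈ K.powerset, res G L ⊗ₜ[ℚ] res G (K \ L) := by
  rw [res, comulHom_basisVec, comulClass_of]
  refine Finset.sum_bij' (fun L _ => L.map (Function.Embedding.subtype _))
    (fun L _ => L.subtype (· ∈ K)) ?_ ?_ ?_ ?_ ?_
  · intro L _
    rw [Finset.mem_powerset]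
    intro x hx
    obtain ⟨y, -, rfl⟩ := Finset.mem_map.1 hx
    exact y.2
  · intro L _; exact Finset.mem_univ _
  · intro L _
    ext x
    simp
  · intro L hL
    ext x
    rw [Finset.mem_powerset] at hL
    simp only [Finset.mem_map, Finset.mem_subtype]
    constructor
    · rintro ⟨y, hy, rfl⟩; exact hy
    · intro hx; exact ⟨⟨x, hL hx⟩, hx, rfl⟩
  · intro L _
    rw [res_eq (restrict_restrict_iso G K L), res_eq (restrict_restrict_iso G K Lᶜ)]
    congr 2
    ext x
    simp only [Finset.mem_map, Finset.mem_compl, Finset.mem_sdiff,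
      Function.Embedding.subtype_apply, Subtype.exists, exists_and_right, exists_eq_right]
    constructor
    · rintro ⟨h1, h2⟩; exact ⟨h1, fun ⟨_, h3⟩ => h2 h3⟩
    · rintro ⟨h1, h2⟩; exact ⟨h1, fun h3 => h2 ⟨h1, h3⟩⟩

theorem coassoc_aux {V : Type*} [Fintype V] [DecidableEq V] {A : Type*} [AddCommMonoid A]
    (T : Finset V → Finset V → Finset V → A) :
    ∑ K : Finset V, ∑ L ∈ K.powerset, T L (K \ L) Kᶜ =
      ∑ K : Finset V, ∑ M ∈ Kᶜ.powerset, T K M (Kᶜ \ M) := by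
  rw [Finset.sum_sigma', Finset.sum_sigma']
  refine Finset.sum_bij' (fun p _ => ⟨p.2, p.1 \ p.2⟩) (fun p _ => ⟨p.1 ∪ p.2, p.1⟩) ?_ ?_ ?_ ?_ ?_
  · rintro ⟨K, L⟩ h
    simp only [Finset.mem_sigma, Finset.mem_univ, true_and, Finset.mem_powerset] at h ⊢
    intro x; simp
  · rintro ⟨K, M⟩ h
    simp only [Finset.mem_sigma, Finset.mem_univ, true_and, Finset.mem_powerset]
    exact Finset.subset_union_left
  · rintro ⟨K, L⟩ h
    simp only [Finset.mem_sigma, Finset.mem_univ, true_and, Finset.mem_powerset] at h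
    simp [Finset.union_eq_right.2 h]
  · rintro ⟨K, M⟩ h
    simp only [Finset.mem_sigma, Finset.mem_univ, true_and, Finset.mem_powerset] at h
    have : (K ∪ M) \ K = M := by
      ext x
      have := @h x
      simp at this ⊢
      tauto
    simp [this]
  · rintro ⟨K, L⟩ h
    simp only [Finset.mem_sigma, Finset.mem_univ, true_and, Finset.mem_powerset] at h
    congr 1
    ext x
    have := @h x
    simp
    tauto

instance : Bialgebra ℚ HypergraphAlgebra :=
  Bialgebra.ofAlgHom comulHom counitHom
    (algHom_ext fun {n} G => by
      simp only [AlgHom.comp_apply, comulHom_basisVec, comulClass_of, map_sum,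
        Algebra.TensorProduct.map_tmul, comulHom_res, AlgHom.id_apply, TensorProduct.sum_tmul,
        TensorProduct.tmul_sum]
      exact coassoc_aux fun K L M => res G K ⊗ₜ[ℚ] (res G L ⊗ₜ[ℚ] res G M))
    (algHom_ext fun {n} G => by
      simp only [AlgHom.comp_apply, comulHom_basisVec, comulClass_of, map_sum,
        Algebra.TensorProduct.map_tmul, AlgHom.id_apply, counitHom_res]
      rw [Finset.sum_eq_single ∅ (fun K _ hK => by rw [if_neg hK, TensorProduct.zero_tmul])
        (fun h => absurd (Finset.mem_univ _) h), if_pos rfl, Finset.compl_empty, res_univ]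
      rfl)
    (algHom_ext fun {n} G => by
      simp only [AlgHom.comp_apply, comulHom_basisVec, comulClass_of, map_sum,
        Algebra.TensorProduct.map_tmul, AlgHom.id_apply, counitHom_res]
      rw [Finset.sum_eq_single Finset.univ
        (fun K _ hK => by
          rw [if_neg (fun h => hK (Finset.compl_eq_empty_iff K |>.1 h)), TensorProduct.tmul_zero])
        (fun h => absurd (Finset.mem_univ _) h), Finset.compl_univ, if_pos rfl, res_univ]
      rfl)

end HypergraphAlgebra

/-- `S` is an antipode of the bialgebra `A`: a two-sided convolution inverse of the identity. -/
structure IsAntipode (R : Type*) {A : Type*} [CommRing R] [Ring A] [Bialgebra R A]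
    (S : A →ₗ[R] A) : Prop where
  left : LinearMap.mul' R A ∘ₗ S.rTensor A ∘ₗ Coalgebra.comul =
    Algebra.linearMap R A ∘ₗ Coalgebra.counit
  right : LinearMap.mul' R A ∘ₗ S.lTensor A ∘ₗ Coalgebra.comul =
    Algebra.linearMap R A ∘ₗ Coalgebra.counit

namespace SimpleHypergraph

section Flats
variable {V : Type*}

/-- A set composition of `V`: a sequence of nonempty, pairwise disjoint subsets with union `V`. -/
structure IsSetComposition (A : List (Finset V)) : Prop where
  nonempty : ∀ P ∈ A, P.Nonempty
  pairwise_disjoint : A.Pairwise Disjoint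
  cover : ∀ v, ∃ P ∈ A, v ∈ P

open scoped Classical in
/-- `G|_A`, the hyperedges of `G` that are contained in some part of `A`. -/
def compRestrict (G : SimpleHypergraph V) (A : List (Finset V)) : SimpleHypergraph V where
  edges := G.edges.filter fun U => ∃ P ∈ A, U ⊆ P
  two_le_card U hU := G.two_le_card U (Finset.mem_filter.1 hU).1

open scoped Classical in
/-- The set of flats of `G`. -/
def flats [Finite V] (G : SimpleHypergraph V) : Finset (SimpleHypergraph V) :=
  Finset.univ.filter fun F => ∃ A : List (Finset V), IsSetComposition A ∧ F = G.compRestrict A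

/-- The equivalence relation on `V` that contracts every hyperedge of `F` to a point. -/
def contractSetoid (F : SimpleHypergraph V) : Setoid V :=
  Relation.EqvGen.setoid fun a b => ∃ U ∈ F.edges, a ∈ U ∧ b ∈ U

/-- `V/F`, the vertices obtained by contracting every hyperedge of `F`. For a flat `F` its elements
are the parts of the finest set composition `A` with `F = G|_A`. -/
abbrev Contracted (F : SimpleHypergraph V) : Type _ := Quotient F.contractSetoid

open scoped Classical in
/-- The contraction `G/F`, a hypergraph on `V/F`: its hyperedges are the images of the hyperedges
of `G` that are not contracted to a point. -/
def contract (G F : SimpleHypergraph V) : SimpleHypergraph F.Contracted where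
  edges := (G.edges.image fun U => U.image (Quotient.mk F.contractSetoid)).filter
    fun U => 2 ≤ U.card
  two_le_card _ hU := (Finset.mem_filter.1 hU).2

end Flats

section Orientations
variable {V : Type*}

/-- An orientation of `G`: every hyperedge `U` is split into a nonempty head and a nonempty
complement of the head in `U`. -/
@[ext]
structure Orientation (G : SimpleHypergraph V) where
  head : {U // U ∈ G.edges} → Finset V
  head_nonempty : ∀ U, (head U).Nonempty
  head_ssubset : ∀ U, head U ⊂ U.1

namespace Orientation
variable {G : SimpleHypergraph V}

instance [Finite V] : Finite (Orientation G) :=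
  Finite.of_injective (Orientation.head : Orientation G → _) fun _ _ h => Orientation.ext h

/-- The equivalence relation generated by identifying the elements of every head. -/
def setoid (O : Orientation G) : Setoid V :=
  Relation.EqvGen.setoid fun a b => ∃ U, a ∈ O.head U ∧ b ∈ O.head U

/-- The vertex set `V/O` of the oriented graph `G/O`. -/
abbrev Vertex (O : Orientation G) : Type _ := Quotient O.setoid

/-- The arrows of the oriented graph `G/O`: from the class of the head of a hyperedge to the classes
of the elements of the hyperedge outside the head. -/
def Arrow (O : Orientation G) (x y : O.Vertex) : Prop :=
  ∃ U, ∃ a ∈ O.head U, ∃ b ∈ U.1, b ∉ O.head U ∧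
    x = Quotient.mk O.setoid a ∧ y = Quotient.mk O.setoid b

/-- `O` is acyclic if the oriented graph `G/O` has no cycles (loops count as cycles). -/
def Acyclic (O : Orientation G) : Prop := ∀ x : O.Vertex, ¬ Relation.TransGen O.Arrow x x

end Orientation

/-- The set of acyclic orientations of `G`. -/
abbrev AcyclicOrientation (G : SimpleHypergraph V) : Type _ :=
  {O : Orientation G // O.Acyclic}

instance [Finite V] (G : SimpleHypergraph V) : Fintype (AcyclicOrientation G) :=
  Fintype.ofFinite _

end Orientations

section Psi
variable {W ι : Type*} [LinearOrder ι]

open scoped Classical in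
/-- The sources of the restriction to `T` of the oriented graph with arrows `r`. -/
def sources (r : W → W → Prop) (T : Finset W) : Finset W :=
  T.filter fun y => ∀ x ∈ T, ¬ r x y

open scoped Classical in
/-- Repeatedly take the source with maximal key and remove it from the graph. -/
def sourceOrder (r : W → W → Prop) (key : W → ι) (T : Finset W) : List W :=
  if h : (sources r T).Nonempty then
    (Finset.exists_max_image (sources r T) key h).choose ::
      sourceOrder r key (T.erase (Finset.exists_max_image (sources r T) key h).choose)
  else []
termination_by T.card
decreasing_by
  exact Finset.card_erase_lt_of_mem (Finset.mem_filter.1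
    (Finset.exists_max_image (sources r T) key h).choose_spec.1).1

end Psi

section Antipode
variable {n : ℕ}

/-- For an orientation `O` of `G/F`, the vertex of `(G/F)/O` that contains `i`. -/
def vertexOf {G F : SimpleHypergraph (Fin n)} (O : Orientation (G.contract F)) (i : Fin n) :
    O.Vertex :=
  Quotient.mk O.setoid (Quotient.mk F.contractSetoid i)

open scoped Classical in
/-- A vertex of `(G/F)/O`, viewed as a part of the set partition `[n]/O` of `Fin n`. -/
def block {G F : SimpleHypergraph (Fin n)} (O : Orientation (G.contract F)) (x : O.Vertex) :
    Finset (Fin n) :=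
  Finset.univ.filter fun i => vertexOf O i = x

open scoped Classical in
/-- The set composition `Ψ(O) = (A₁, …, A_k)`: `A_i` is the source with the largest minimum of the
oriented graph `(G/F)/O` restricted to the vertices other than `A₁, …, A_{i-1}`. -/
def psi {G F : SimpleHypergraph (Fin n)} (O : Orientation (G.contract F)) :
    List (Finset (Fin n)) :=
  letI : Fintype O.Vertex := Fintype.ofFinite _
  (sourceOrder O.Arrow (fun x => (block O x).min) Finset.univ).map (block O)

/-- `a(G/F)`, the sum of `(-1) ^ ℓ(Ψ(O))` over the acyclic orientations `O` of `G/F`. -/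
def antipodeCoeff (G F : SimpleHypergraph (Fin n)) : ℤ :=
  ∑ O : AcyclicOrientation (G.contract F), (-1) ^ (psi O.1).length

/-- The simplex with vertices the standard basis vectors `e_i`, `i ∈ U`. -/
def simplex (U : Finset (Fin n)) : Set (Fin n → ℝ) :=
  convexHull ℝ ((fun i => Pi.single i (1 : ℝ)) '' (U : Set (Fin n)))

/-- The hypergraphic polytope `P_G`, the Minkowski sum of the simplices of the hyperedges. -/
def polytope (G : SimpleHypergraph (Fin n)) : Set (Fin n → ℝ) := ∑ U ∈ G.edges, simplex U

/-- The cone `C_O` of an orientation `O` of `G/F`; a functional is given by its values on the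
standard basis. -/
def orientationCone {G F : SimpleHypergraph (Fin n)} (O : Orientation (G.contract F)) :
    Set (Fin n → ℝ) :=
  {x | (∀ a b, vertexOf O a = vertexOf O b → x a = x b) ∧
    ∀ a b, O.Arrow (vertexOf O a) (vertexOf O b) → x b ≤ x a}

end Antipode

end SimpleHypergraph

section Polytopes
variable {n : ℕ}

/-- `f` is a nonempty face of the polytope `P`: the set of points of `P` at which some linear
functional attains its maximum over `P`. -/
def IsFace (P f : Set (Fin n → ℝ)) : Prop := f.Nonempty ∧ IsExposed ℝ P f

/-- The normal cone of `P` at `f`: the linear functionals that attain their maximum over `P` at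
every point of `f`. -/
def normalCone (P f : Set (Fin n → ℝ)) : Set (Fin n → ℝ) :=
  {x | ∀ p ∈ f, ∀ q ∈ P, x ⬝ᵥ q ≤ x ⬝ᵥ p}

/-- The Euler characteristic of a subset `X` of a polytope `P` that is a union of relative interiors
of faces of `P`: the sum of `(-1) ^ dim f` over the faces `f` of `P` with relative interior
in `X`. -/
def eulerChar (P X : Set (Fin n → ℝ)) : ℤ :=
  ∑ᶠ f ∈ {f | IsFace P f ∧ intrinsicInterior ℝ f ⊆ X},
    (-1) ^ Module.finrank ℝ (vectorSpan ℝ f)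

/-- The face `f` of `P_G` is indexed by the orientation `O` of `G/F`: its normal cone is `C_O`. -/
def IsIndexedBy {G F : SimpleHypergraph (Fin n)} (f : Set (Fin n → ℝ))
    (O : SimpleHypergraph.Orientation (G.contract F)) : Prop :=
  IsFace G.polytope f ∧ normalCone G.polytope f = SimpleHypergraph.orientationCone O

/-- The union of the (relatively open) faces of `P_G` that are indexed by the acyclic orientations
of `G/F`. -/
def acyclicFaceUnion (G F : SimpleHypergraph (Fin n)) : Set (Fin n → ℝ) :=
  {p | ∃ O : SimpleHypergraph.AcyclicOrientation (G.contract F), ∃ f,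
    IsIndexedBy f O.1 ∧ p ∈ intrinsicInterior ℝ f}

end Polytopes

end

/-! The coproduct splits a hypergraph over the subsets of its vertex set, so the antipode identity
is a recursion over subsets in which the full set occurs with coefficient one. This gives existence
and uniqueness. Solving the recursion yields Takeuchi's formula (`IsAntipode.apply_res`): `S(G)` is
the sum of `(-1)^ℓ(A) G|_A` over all set compositions `A`.

The terms are then grouped by labellings. A function `x` from the vertices to a linear order
determines a flat `F`, consisting of the hyperedges on which `x` is constant, and an orientation of
`G/F`, whose heads are the loci where `x` is maximal. This orientation is acyclic because `x` drops
along arrows. The relation `IsCompatible` records that `x` induces a given orientation. Applied to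
the position of a vertex in `A`, with the order reversed, it assigns to each `A` exactly one pair
`(F, O)` with `F = G|_A` (`res_compRestrict_eq_sum`). It remains to sum `(-1)^ℓ(A)` over the `A`
that induce a fixed `O`. By `sum_isLayering` the sum is `(-1)^k`, with `k` the number of vertices of
the oriented graph: peel off the first part, which must be a nonempty set of sources, and use that
the alternating sum over all subsets of a nonempty set vanishes. Since `Ψ(O)` lists every vertex
once, this is also `(-1)^ℓ(Ψ(O))`, and no explicit sign-reversing involution is needed.

The same relation with real labels gives the geometry. The functional `x` attains its maximum over
`P_G` on a face that depends only on where `x` is maximal on each hyperedge. If `x` is compatible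
with `O`, this face has normal cone `C_O` (`IsCompatible.normalCone_maxFace`), and the functionals
constant on it are those constant on the vertices of the oriented graph, so its dimension is `n - k`
(`IsCompatible.finrank_vectorSpan_maxFace`). A face is determined by its normal cone and `O` by its
cone, and distinct faces have disjoint relative interiors. So the faces counted by the Euler
characteristic are in bijection with the acyclic orientations, with matching signs. -/

noncomputable section


/-! ### Existence and uniqueness of the antipode. -/

namespace HypergraphAlgebra
open SimpleHypergraph

section Antipode

theorem comul_res {V : Type*} [Fintype V] [DecidableEq V] (G : SimpleHypergraph V) (K : Finset V) :
    Coalgebra.comul (R := ℚ) (res G K) = ∑ L ∈ K.powerset, res G L ⊗ₜ[ℚ] res G (K \ L) :=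
  comulHom_res G K

theorem counit_res {V : Type*} [DecidableEq V] (G : SimpleHypergraph V) (K : Finset V) :
    Coalgebra.counit (R := ℚ) (res G K) = if K = ∅ then 1 else 0 :=
  counitHom_res G K

/-- The isomorphism classes of hypergraphs form a basis of `H`. -/
def basis : Module.Basis HypergraphClass ℚ HypergraphAlgebra :=
  MonoidAlgebra.basis HypergraphClass ℚ

theorem basis_apply (c : HypergraphClass) : basis c = basisVec c :=
  MonoidAlgebra.basis_apply ..

theorem exists_mk_eq (c : HypergraphClass) :
    ∃ G : SimpleHypergraph (Fin c.size), HypergraphClass.mk G = c := by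
  induction c using HypergraphClass.ind with | h n G
  exact ⟨G, rfl⟩

/-- A representative of an isomorphism class. -/
def rep (c : HypergraphClass) : SimpleHypergraph (Fin c.size) := (exists_mk_eq c).choose

theorem mk_rep (c : HypergraphClass) : HypergraphClass.mk (rep c) = c := (exists_mk_eq c).choose_spec

theorem res_rep (c : HypergraphClass) : res (rep c) Finset.univ = basisVec c := by
  rw [res_univ, HypergraphClass.of_fin, mk_rep]

theorem linearMap_ext {M : Type*} [AddCommGroup M] [Module ℚ M] {f g : HypergraphAlgebra →ₗ[ℚ] M}
    (h : ∀ c, f (res (rep c) Finset.univ) = g (res (rep c) Finset.univ)) : f = g := by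
  refine basis.ext fun c => ?_
  rw [basis_apply, ← res_rep]
  exact h c

theorem convolution_left_res {V : Type*} [Fintype V] [DecidableEq V]
    (S : HypergraphAlgebra →ₗ[ℚ] HypergraphAlgebra) (G : SimpleHypergraph V) (K : Finset V) :
    (LinearMap.mul' ℚ HypergraphAlgebra ∘ₗ S.rTensor HypergraphAlgebra ∘ₗ Coalgebra.comul)
      (res G K) = ∑ L ∈ K.powerset, S (res G L) * res G (K \ L) := by
  simp [comul_res, map_sum]

theorem convolution_right_res {V : Type*} [Fintype V] [DecidableEq V]
    (S : HypergraphAlgebra →ₗ[ℚ] HypergraphAlgebra) (G : SimpleHypergraph V) (K : Finset V) :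
    (LinearMap.mul' ℚ HypergraphAlgebra ∘ₗ S.lTensor HypergraphAlgebra ∘ₗ Coalgebra.comul)
      (res G K) = ∑ L ∈ K.powerset, res G L * S (res G (K \ L)) := by
  simp [comul_res, map_sum]

theorem unit_counit_res {V : Type*} [Fintype V] [DecidableEq V]
    (G : SimpleHypergraph V) (K : Finset V) :
    (Algebra.linearMap ℚ HypergraphAlgebra ∘ₗ Coalgebra.counit) (res G K) =
      if K = ∅ then 1 else 0 := by
  rw [LinearMap.comp_apply, counit_res]
  split_ifs <;> simp

theorem sum_powerset_sdiff {V M : Type*} [DecidableEq V] [AddCommMonoid M] (K : Finset V)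
    (f : Finset V → Finset V → M) :
    ∑ L ∈ K.powerset, f L (K \ L) = ∑ L ∈ K.powerset, f (K \ L) L := by
  refine Finset.sum_bij' (fun L _ => K \ L) (fun L _ => K \ L) ?_ ?_ ?_ ?_ ?_
  · exact fun L _ => Finset.mem_powerset.2 Finset.sdiff_subset
  · exact fun L _ => Finset.mem_powerset.2 Finset.sdiff_subset
  · intro L hL; exact Finset.sdiff_sdiff_eq_self (Finset.mem_powerset.1 hL)
  · intro L hL; exact Finset.sdiff_sdiff_eq_self (Finset.mem_powerset.1 hL)
  · intro L hL
    rw [Finset.sdiff_sdiff_eq_self (Finset.mem_powerset.1 hL)]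

/-- By commutativity of the product and the symmetry `L ↔ K \ L`, a left convolution inverse is also
a right one. It is enough to test it on one representative of each class. -/
theorem isAntipode_of_sum {S : HypergraphAlgebra →ₗ[ℚ] HypergraphAlgebra}
    (h : ∀ c : HypergraphClass, ∑ L ∈ (Finset.univ : Finset (Fin c.size)).powerset,
      S (res (rep c) L) * res (rep c) (Finset.univ \ L) =
        if (Finset.univ : Finset (Fin c.size)) = ∅ then 1 else 0) :
    IsAntipode ℚ S where
  left := linearMap_ext fun c => by rw [convolution_left_res, unit_counit_res, h]
  right := linearMap_ext fun c => by
    rw [convolution_right_res, unit_counit_res, ← h c,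
      sum_powerset_sdiff Finset.univ fun A B => S (res (rep c) A) * res (rep c) B]
    exact Finset.sum_congr rfl fun L _ => mul_comm _ _

theorem IsAntipode.sum_res {V : Type*} [Fintype V] [DecidableEq V]
    {S : HypergraphAlgebra →ₗ[ℚ] HypergraphAlgebra} (h : IsAntipode ℚ S)
    (G : SimpleHypergraph V) (K : Finset V) :
    ∑ L ∈ K.powerset, res G L * S (res G (K \ L)) = if K = ∅ then 1 else 0 := by
  rw [← convolution_right_res, h.right, unit_counit_res]

/-- A convolution inverse of a family `r` with `r ∅ = 1` is unique. -/
theorem eq_of_sum_powerset_mul {V A : Type*} [DecidableEq V] [Ring A] {r s t : Finset V → A}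
    (hr : r ∅ = 1)
    (h : ∀ K, ∑ L ∈ K.powerset, r L * s (K \ L) = ∑ L ∈ K.powerset, r L * t (K \ L)) : s = t := by
  funext K
  induction K using Finset.strongInduction with | H K ih =>
  have hK := h K
  -- Every `L ≠ ∅` leaves a proper subset `K \ L`, covered by induction; the term `L = ∅` is then `s
  -- K` on one side and `t K` on the other.
  have hsum : ∑ L ∈ K.powerset.erase ∅, r L * s (K \ L) =
      ∑ L ∈ K.powerset.erase ∅, r L * t (K \ L) := Finset.sum_congr rfl fun L hL => by
    rw [Finset.mem_erase, Finset.mem_powerset] at hL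
    rw [ih (K \ L) (Finset.sdiff_ssubset hL.2 (Finset.nonempty_iff_ne_empty.2 hL.1))]
  rw [← Finset.sum_erase_add _ _ (Finset.empty_mem_powerset K), hsum,
    ← Finset.sum_erase_add K.powerset (fun L => r L * t (K \ L))
      (Finset.empty_mem_powerset K)] at hK
  rwa [add_left_cancel_iff, hr, one_mul, one_mul, Finset.sdiff_empty] at hK

/-- The antipode on isomorphism classes, by recursion on the number of vertices. -/
def antipodeClass (c : HypergraphClass) : HypergraphAlgebra :=
  if c.size = 0 then 1 else
    -∑ K : {K : Finset (Fin c.size) // K ≠ Finset.univ},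
      antipodeClass (HypergraphClass.of ((rep c).restrict K.1)) *
        res (rep c) (Finset.univ \ K.1)
termination_by c.size
decreasing_by
  rw [HypergraphClass.size_of, Fintype.card_coe]
  exact (Finset.card_lt_univ_of_notMem (Classical.not_forall.1 fun h => K.2
    (Finset.eq_univ_iff_forall.2 h)).choose_spec).trans_eq (Fintype.card_fin _)

/-- The antipode of `H`. -/
def antipode : HypergraphAlgebra →ₗ[ℚ] HypergraphAlgebra := basis.constr ℚ antipodeClass

theorem antipode_basisVec (c : HypergraphClass) : antipode (basisVec c) = antipodeClass c := by
  rw [← basis_apply, antipode, Module.Basis.constr_basis]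

/-- The recursion defining `antipodeClass` is the antipode identity solved for the term of the full
vertex set. -/
theorem isAntipode_antipode : IsAntipode ℚ antipode := by
  refine isAntipode_of_sum fun c => ?_
  have he : (Finset.univ : Finset (Fin c.size)) = ∅ ↔ c.size = 0 := by
    rw [← Finset.card_eq_zero, Finset.card_univ, Fintype.card_fin]
  rw [Finset.powerset_univ, ← Finset.sum_erase_add _ _ (Finset.mem_univ Finset.univ), res_rep,
    antipode_basisVec, Finset.sdiff_self, res_empty, mul_one, antipodeClass]
  have hs : ∀ f : Finset (Fin c.size) → HypergraphAlgebra,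
      ∑ K ∈ Finset.univ.erase Finset.univ, f K =
        ∑ K : {K : Finset (Fin c.size) // K ≠ Finset.univ}, f K :=
    fun f => Finset.sum_subtype _ (by simp) f
  rw [hs]
  simp only [he]
  split_ifs with h
  · rw [Fintype.sum_eq_zero, zero_add]
    exact fun K => absurd ((Finset.subset_univ K.1).antisymm
      ((he.2 h).subset.trans (Finset.empty_subset _))) K.2
  · rw [add_neg_eq_zero]
    exact Finset.sum_congr rfl fun K _ => congrArg₂ _ (antipode_basisVec _) rfl

theorem IsAntipode.unique {S T : HypergraphAlgebra →ₗ[ℚ] HypergraphAlgebra}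
    (hS : IsAntipode ℚ S) (hT : IsAntipode ℚ T) : S = T :=
  linearMap_ext fun c => congrFun (eq_of_sum_powerset_mul (r := res (rep c))
    (s := fun K => S (res (rep c) K)) (t := fun K => T (res (rep c) K)) (res_empty _) fun K => by
      rw [IsAntipode.sum_res hS, IsAntipode.sum_res hT]) Finset.univ

end Antipode
end HypergraphAlgebra

/-! ### Set compositions, enumerated by their first part. -/

/-- The set compositions of a finite set. -/
def setCompositions {V : Type*} [DecidableEq V] (K : Finset V) : Finset (List (Finset V)) :=
  if K = ∅ then {[]} else
    (K.powerset.erase ∅).attach.biUnion fun B =>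
      (setCompositions (K \ B.1)).image (List.cons B.1)
termination_by K.card
decreasing_by
  have h := Finset.mem_erase.1 B.2
  exact Finset.card_lt_card (Finset.sdiff_ssubset (Finset.mem_powerset.1 h.2)
    (Finset.nonempty_iff_ne_empty.2 h.1))

section SetCompositions
variable {V : Type*} [DecidableEq V]

theorem setCompositions_empty : setCompositions (∅ : Finset V) = {[]} := by
  rw [setCompositions, if_pos rfl]

theorem mem_setCompositions_cons {K B : Finset V} {A : List (Finset V)} :
    B :: A ∈ setCompositions K ↔ B.Nonempty ∧ B ⊆ K ∧ A ∈ setCompositions (K \ B) := by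
  rw [setCompositions]
  split_ifs with h
  · subst h
    refine iff_of_false (by simp) fun h => ?_
    exact h.1.ne_empty (Finset.subset_empty.1 h.2.1)
  · simp only [Finset.mem_biUnion, Finset.mem_attach, true_and, Subtype.exists, Finset.mem_image,
      List.cons.injEq, Finset.mem_erase, Finset.mem_powerset, Finset.nonempty_iff_ne_empty]
    constructor
    · rintro ⟨B', hB', A', hA', rfl, rfl⟩
      exact ⟨hB'.1, hB'.2, hA'⟩
    · rintro ⟨h1, h2, h3⟩
      exact ⟨B, ⟨h1, h2⟩, A, h3, rfl, rfl⟩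

theorem nil_mem_setCompositions {K : Finset V} : [] ∈ setCompositions K ↔ K = ∅ := by
  rw [setCompositions]
  split_ifs with h
  · simp [h]
  · simp [h]

theorem sum_setCompositions {M : Type*} [AddCommMonoid M] {K : Finset V} (hK : K.Nonempty)
    (f : List (Finset V) → M) :
    ∑ A ∈ setCompositions K, f A =
      ∑ B ∈ K.powerset.erase ∅, ∑ A ∈ setCompositions (K \ B), f (B :: A) := by
  rw [Finset.sum_sigma']
  refine (Finset.sum_bij' (fun p _ => p.1 :: p.2) (fun A _ => ⟨A.headD ∅, A.tail⟩) ?_ ?_ ?_ ?_ ?_).symm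
  · rintro ⟨B, A⟩ h
    simp only [Finset.mem_sigma, Finset.mem_erase, Finset.mem_powerset] at h
    exact mem_setCompositions_cons.2 ⟨Finset.nonempty_iff_ne_empty.2 h.1.1, h.1.2, h.2⟩
  · rintro (_ | ⟨B, A⟩) h
    · exact absurd (nil_mem_setCompositions.1 h) hK.ne_empty
    · rw [mem_setCompositions_cons] at h
      simp only [Finset.mem_sigma, Finset.mem_erase, Finset.mem_powerset]
      exact ⟨⟨h.1.ne_empty, h.2.1⟩, h.2.2⟩
  · exact fun _ _ => rfl
  · rintro (_ | ⟨B, A⟩) h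
    · exact absurd (nil_mem_setCompositions.1 h) hK.ne_empty
    · rfl
  · exact fun _ _ => rfl

theorem mem_iff_of_mem_setCompositions {A : List (Finset V)} {K : Finset V}
    (h : A ∈ setCompositions K) (v : V) : v ∈ K ↔ ∃ P ∈ A, v ∈ P := by
  induction A generalizing K with
  | nil => simp [nil_mem_setCompositions.1 h]
  | cons B A ih =>
    obtain ⟨-, hB, hA⟩ := mem_setCompositions_cons.1 h
    have := ih hA
    rw [Finset.mem_sdiff] at this
    rw [List.exists_mem_cons_iff, ← this]
    have := @hB v
    tauto

theorem isSetComposition_of_mem [Fintype V] {A : List (Finset V)}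
    (h : A ∈ setCompositions Finset.univ) : SimpleHypergraph.IsSetComposition A := by
  have key : ∀ K : Finset V, A ∈ setCompositions K → (∀ P ∈ A, P.Nonempty) ∧ A.Pairwise Disjoint := by
    clear h
    induction A with
    | nil => simp
    | cons B A ih =>
      intro K h
      obtain ⟨hB, -, hA⟩ := mem_setCompositions_cons.1 h
      obtain ⟨h1, h2⟩ := ih _ hA
      refine ⟨by simpa using ⟨hB, h1⟩, List.pairwise_cons.2 ⟨fun P hP => ?_, h2⟩⟩
      rw [Finset.disjoint_left]
      intro v hv hvP
      have := (mem_iff_of_mem_setCompositions hA v).2 ⟨P, hP, hvP⟩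
      exact (Finset.mem_sdiff.1 this).2 hv
  exact ⟨(key _ h).1, (key _ h).2, fun v =>
    (mem_iff_of_mem_setCompositions h v).1 (Finset.mem_univ v)⟩

/-- The position of the first part that contains `v`. -/
def partIndex (A : List (Finset V)) (v : V) : ℕ := A.findIdx (fun P => v ∈ P)

theorem partIndex_cons (B : Finset V) (A : List (Finset V)) (v : V) :
    partIndex (B :: A) v = if v ∈ B then 0 else partIndex A v + 1 := by
  by_cases h : v ∈ B <;> simp [partIndex, List.findIdx_cons, h]

/-- Translates `G|_A` into labels: a hyperedge survives exactly when the position function is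
constant on it. -/
theorem exists_part_iff {A : List (Finset V)} {K U : Finset V} (h : A ∈ setCompositions K)
    (hU : U ⊆ K) (hne : U.Nonempty) :
    (∃ P ∈ A, U ⊆ P) ↔ ∀ a ∈ U, ∀ b ∈ U, partIndex A a = partIndex A b := by
  induction A generalizing K with
  | nil =>
    rw [nil_mem_setCompositions] at h
    exact absurd (Finset.subset_empty.1 (h ▸ hU)) hne.ne_empty
  | cons B A ih =>
    obtain ⟨-, hB, hA⟩ := mem_setCompositions_cons.1 h
    simp only [List.mem_cons, exists_eq_or_imp, partIndex_cons]
    by_cases hd : Disjoint U B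
    · rw [Finset.disjoint_left] at hd
      have hUB : ¬ U ⊆ B := fun h' => hd hne.choose_spec (h' hne.choose_spec)
      rw [or_iff_right hUB, ih hA fun v hv => Finset.mem_sdiff.2 ⟨hU hv, hd hv⟩]
      refine forall₂_congr fun a ha => forall₂_congr fun b hb => ?_
      rw [if_neg (hd ha), if_neg (hd hb), Nat.add_right_cancel_iff]
    · obtain ⟨v, hvU, hvB⟩ := Finset.not_disjoint_iff.1 hd
      constructor
      · rintro (hUB | ⟨P, hP, hUP⟩)
        · intro a ha b hb
          rw [if_pos (hUB ha), if_pos (hUB hb)]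
        · have := (mem_iff_of_mem_setCompositions hA v).2 ⟨P, hP, hUP hvU⟩
          exact absurd hvB (Finset.mem_sdiff.1 this).2
      · intro hc
        refine Or.inl fun a ha => ?_
        have := hc a ha v hvU
        rw [if_pos hvB] at this
        by_contra hn
        rw [if_neg hn] at this
        omega

end SetCompositions

/-! ### The signed count of set compositions adapted to an acyclic relation. -/

section Layers
variable {V W : Type*} [DecidableEq V] [Fintype V] [DecidableEq W] (q : V → W) (r : W → W → Prop)

/-- The order of the parts of `A` respects, on `K`, the classes of `q` and the relation `r`. -/
def IsLayering (K : Finset V) (A : List (Finset V)) : Prop :=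
  (∀ a ∈ K, ∀ b ∈ K, q a = q b → partIndex A a = partIndex A b) ∧
    ∀ a ∈ K, ∀ b ∈ K, r (q a) (q b) → partIndex A a < partIndex A b

/-- The union of the classes in `T`. -/
def preim (T : Finset W) : Finset V := Finset.univ.filter fun v => q v ∈ T

variable {q r}

omit [DecidableEq V] in
theorem mem_preim {T : Finset W} {v : V} : v ∈ preim q T ↔ q v ∈ T := by simp [preim]

theorem preim_sdiff (T D : Finset W) : preim q (T \ D) = preim q T \ preim q D := by
  ext v; simp [mem_preim]

omit [DecidableEq V] in
theorem preim_injective (hq : Function.Surjective q) : Function.Injective (preim q) := by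
  intro S T h
  ext w
  obtain ⟨v, rfl⟩ := hq w
  rw [← mem_preim, h, mem_preim]

omit [DecidableEq W] in
theorem mem_sources {T : Finset W} {w : W} :
    w ∈ SimpleHypergraph.sources r T ↔ w ∈ T ∧ ∀ x ∈ T, ¬ r x w := by
  simp [SimpleHypergraph.sources]

/-- The first part has index `0`, the least possible. Hence it is a union of classes, and no arrow
from inside `T` can end in it, which says that its classes are sources. Arrows that start in the
first part impose nothing further on `A`. -/
theorem isLayering_cons (hq : Function.Surjective q) {T : Finset W} {B : Finset V}
    {A : List (Finset V)} (hB : B ⊆ preim q T) :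
    IsLayering q r (preim q T) (B :: A) ↔
      ∃ D ⊆ SimpleHypergraph.sources r T, preim q D = B ∧ IsLayering q r (preim q (T \ D)) A := by
  constructor
  · rintro ⟨h1, h2⟩
    simp only [partIndex_cons] at h1 h2
    have hsat : ∀ a ∈ B, ∀ b, q a = q b → b ∈ B := by
      intro a ha b hab
      have hbT : b ∈ preim q T := mem_preim.2 (hab ▸ mem_preim.1 (hB ha))
      have := h1 a (hB ha) b hbT hab
      rw [if_pos ha] at this
      by_contra hb
      rw [if_neg hb] at this
      omega
    have hpre : preim q (B.image q) = B := by
      ext v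
      rw [mem_preim, Finset.mem_image]
      exact ⟨fun ⟨a, ha, hav⟩ => hsat a ha v hav, fun hv => ⟨v, hv, rfl⟩⟩
    refine ⟨B.image q, fun w hw => ?_, hpre, ?_⟩
    · obtain ⟨b, hb, rfl⟩ := Finset.mem_image.1 hw
      refine mem_sources.2 ⟨mem_preim.1 (hB hb), fun x hx hr => ?_⟩
      obtain ⟨a, rfl⟩ := hq x
      have := h2 a (mem_preim.2 hx) b (hB hb) hr
      rw [if_pos hb] at this
      omega
    · rw [preim_sdiff, hpre]
      constructor
      · intro a ha b hb hab
        rw [Finset.mem_sdiff] at ha hb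
        have := h1 a ha.1 b hb.1 hab
        rw [if_neg ha.2, if_neg hb.2] at this
        omega
      · intro a ha b hb hab
        rw [Finset.mem_sdiff] at ha hb
        have := h2 a ha.1 b hb.1 hab
        rw [if_neg ha.2, if_neg hb.2] at this
        omega
  · rintro ⟨D, hD, rfl, h1, h2⟩
    simp only [preim_sdiff, Finset.mem_sdiff] at h1 h2
    constructor
    · intro a ha b hb hab
      have hiff : a ∈ preim q D ↔ b ∈ preim q D := by rw [mem_preim, mem_preim, hab]
      simp only [partIndex_cons, hiff]
      split_ifs with hbD
      · rfl
      · rw [mem_preim] at hbD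
        rw [h1 a ⟨ha, by rwa [mem_preim, hab]⟩ b ⟨hb, by rwa [mem_preim]⟩ hab]
    · intro a ha b hb hab
      have hbD : b ∉ preim q D := fun h =>
        (mem_sources.1 (hD (mem_preim.1 h))).2 _ (mem_preim.1 ha) hab
      rw [partIndex_cons, partIndex_cons, if_neg hbD]
      split_ifs with haD
      · omega
      · have := h2 a ⟨ha, haD⟩ b ⟨hb, hbD⟩ hab
        omega

omit [DecidableEq W] in
-- For an acyclic relation the transitive closure is a strict order, and its minimal elements in `T`
-- are sources.
theorem sources_nonempty (hr : ∀ w, ¬ Relation.TransGen r w w) {T : Finset W} (hT : T.Nonempty) :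
    (SimpleHypergraph.sources r T).Nonempty := by
  have : IsStrictOrder W (Relation.TransGen r) := { irrefl := hr, trans := fun _ _ _ => .trans }
  let _ : PartialOrder W := partialOrderOfSO (Relation.TransGen r)
  obtain ⟨m, hm⟩ := T.exists_minimal hT
  exact ⟨m, mem_sources.2 ⟨hm.prop, fun x hx hxm => hm.not_lt hx (Relation.TransGen.single hxm)⟩⟩

open scoped Classical in
-- Induction on `T`: the first part is the preimage of a nonempty set `D` of sources, and the rest
-- contributes `(-1)^|T \ D|`. The extra part changes the sign, and the sum of `(-1)^|D|` over
-- nonempty `D` is `-1`.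
theorem sum_isLayering (hq : Function.Surjective q) (hr : ∀ w, ¬ Relation.TransGen r w w)
    (T : Finset W) :
    ∑ A ∈ (setCompositions (preim q T)).filter (IsLayering q r (preim q T)),
      (-1 : ℤ) ^ A.length = (-1) ^ T.card := by
  induction T using Finset.strongInduction with | H T ih =>
  obtain rfl | hT := T.eq_empty_or_nonempty
  · have : preim q (∅ : Finset W) = ∅ := by ext; simp [mem_preim]
    rw [this, setCompositions_empty, Finset.filter_singleton, if_pos]
    · simp
    · constructor <;> simp
  have hK : (preim q T).Nonempty := by
    obtain ⟨w, hw⟩ := hT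
    obtain ⟨v, rfl⟩ := hq w
    exact ⟨v, mem_preim.2 hw⟩
  rw [Finset.sum_filter, sum_setCompositions hK]
  have step : ∀ D ∈ (SimpleHypergraph.sources r T).powerset.erase ∅,
      ∑ A ∈ setCompositions (preim q T \ preim q D),
        (if IsLayering q r (preim q T) (preim q D :: A) then (-1 : ℤ) ^ (preim q D :: A).length else 0)
      = - ((-1) ^ T.card * (-1) ^ D.card) := by
    intro D hD
    rw [Finset.mem_erase, Finset.mem_powerset] at hD
    have hDT : D ⊆ T := hD.2.trans fun w hw => (mem_sources.1 hw).1
    have := ih (T \ D) (Finset.sdiff_ssubset hDT (Finset.nonempty_iff_ne_empty.2 hD.1))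
    rw [Finset.card_sdiff_of_subset hDT, Finset.sum_filter] at this
    have hpow : (-1 : ℤ) ^ (T.card - D.card) = (-1) ^ T.card * (-1) ^ D.card := by
      obtain ⟨k, hk⟩ := Nat.exists_eq_add_of_le (Finset.card_le_card hDT)
      rw [hk, Nat.add_sub_cancel_left, pow_add, mul_right_comm, ← mul_pow]
      simp
    rw [← hpow, ← this, ← Finset.sum_neg_distrib, preim_sdiff]
    refine Finset.sum_congr rfl fun A _ => ?_
    have hiff : IsLayering q r (preim q T) (preim q D :: A) ↔
        IsLayering q r (preim q T \ preim q D) A := by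
      rw [isLayering_cons hq fun v hv => mem_preim.2 (hDT (mem_preim.1 hv)), ← preim_sdiff]
      constructor
      · rintro ⟨D', -, h1, h2⟩
        rwa [preim_injective hq h1] at h2
      · exact fun h => ⟨D, hD.2, rfl, h⟩
    simp only [hiff, List.length_cons, pow_succ]
    split_ifs <;> simp
  have hsub : ((SimpleHypergraph.sources r T).powerset.erase ∅).image (preim q) ⊆
      (preim q T).powerset.erase ∅ := by
    intro B hB
    obtain ⟨D, hD, rfl⟩ := Finset.mem_image.1 hB
    rw [Finset.mem_erase, Finset.mem_powerset] at hD ⊢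
    refine ⟨fun h => hD.1 (preim_injective hq ?_), fun v hv => ?_⟩
    · rw [h]; ext; simp [mem_preim]
    · exact mem_preim.2 (mem_sources.1 (hD.2 (mem_preim.1 hv))).1
  -- The first parts that are not preimages of a set of sources contribute zero, so only the sets
  -- `D` remain.
  rw [← Finset.sum_subset hsub, Finset.sum_image (preim_injective hq).injOn,
    Finset.sum_congr rfl step, Finset.sum_neg_distrib, ← Finset.mul_sum]
  · have := Finset.sum_powerset_neg_one_pow_card_of_nonempty (sources_nonempty hr hT)
    rw [← Finset.sum_erase_add _ _ (Finset.empty_mem_powerset _), Finset.card_empty, pow_zero] at this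
    rw [eq_neg_of_add_eq_zero_left this]
    ring
  · intro B hB hB'
    rw [Finset.mem_erase, Finset.mem_powerset] at hB
    refine Finset.sum_eq_zero fun A _ => if_neg fun h => hB' ?_
    obtain ⟨D, hD, rfl, -⟩ := (isLayering_cons hq hB.2).1 h
    refine Finset.mem_image.2 ⟨D, Finset.mem_erase.2 ⟨?_, Finset.mem_powerset.2 hD⟩, rfl⟩
    rintro rfl
    exact hB.1 (by ext; simp [mem_preim])

end Layers

/-! ### The length of the source order. -/

section SourceOrder
variable {W ι : Type*} [LinearOrder ι]

/-- Acyclicity prevents the procedure from stopping while vertices remain, so each vertex is removed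
once, whatever the key is. -/
theorem length_sourceOrder {r : W → W → Prop} (hr : ∀ w, ¬ Relation.TransGen r w w) (key : W → ι)
    (T : Finset W) : (SimpleHypergraph.sourceOrder r key T).length = T.card := by
  classical
  induction h : T.card using Nat.strong_induction_on generalizing T with | _ m ih =>
  rw [SimpleHypergraph.sourceOrder]
  split_ifs with hs
  · have hmem := (mem_sources.1 (Finset.exists_max_image _ key hs).choose_spec.1).1
    have hlt := Finset.card_erase_lt_of_mem hmem
    have hadd := Finset.card_erase_add_one hmem
    rw [List.length_cons, ih _ (h ▸ hlt) _ (by congr!)]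
    rw [← h, ← hadd]
  · rw [← h, eq_comm, List.length_nil, Finset.card_eq_zero]
    by_contra hT
    exact hs (sources_nonempty hr (Finset.nonempty_iff_ne_empty.2 hT))

end SourceOrder

/-! ### Takeuchi's formula. -/

namespace HypergraphAlgebra
open SimpleHypergraph

section Takeuchi
variable {V : Type*} [DecidableEq V]

omit [DecidableEq V] in
-- The product is a disjoint union of isomorphism classes, so it can be realised inside `V` whenever
-- the two vertex sets are disjoint. This replaces products in `H` by restrictions of a single
-- hypergraph on `V`.
theorem res_mul_res {F F' F'' : SimpleHypergraph V} {B C K : Finset V}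
    (hd : Disjoint B C) (hK : ∀ v, v ∈ K ↔ v ∈ B ∨ v ∈ C)
    (h : ∀ U ⊆ K, U ∈ F''.edges ↔ (U ⊆ B ∧ U ∈ F.edges) ∨ (U ⊆ C ∧ U ∈ F'.edges)) :
    res F B * res F' C = res F'' K := by
  rw [res, res, res, ← map_mul, HypergraphClass.of_mul_of]
  refine congrArg basisVec (HypergraphClass.of_eq ?_)
  rw [Finset.disjoint_left] at hd
  let e : {v // v ∈ B} ⊕ {v // v ∈ C} ↪ V := ⟨Sum.elim Subtype.val Subtype.val, by
    rintro (⟨a, ha⟩ | ⟨a, ha⟩) (⟨b, hb⟩ | ⟨b, hb⟩) hab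
    · simpa using hab
    · exact absurd hb (by rw [← show a = b from hab]; exact hd ha)
    · exact absurd ha (by rw [show a = b from hab]; exact hd hb)
    · simpa using hab⟩
  have hl : ∀ b, e (Sum.inl b) = b.1 := fun _ => rfl
  have hr : ∀ c, e (Sum.inr c) = c.1 := fun _ => rfl
  have he : (F.restrict B).sum (F'.restrict C) = F''.comap e := by
    ext U
    have hUK : U.map e ⊆ K := by
      intro v hv
      obtain ⟨(⟨a, ha⟩ | ⟨a, ha⟩), -, rfl⟩ := Finset.mem_map.1 hv
      · exact (hK a).2 (Or.inl ha)
      · exact (hK a).2 (Or.inr ha)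
    rw [mem_comap, h _ hUK, mem_sum']
    have h1 : U.map e ⊆ B ↔ U.toRight = ∅ := by
      constructor
      · intro hU
        ext ⟨c, hc⟩
        simp only [Finset.mem_toRight, Finset.notMem_empty, iff_false]
        exact fun hcU => hd (hU (Finset.mem_map_of_mem e hcU)) hc
      · intro hU v hv
        obtain ⟨(⟨a, ha⟩ | ⟨a, ha⟩), haU, rfl⟩ := Finset.mem_map.1 hv
        · exact ha
        · have := Finset.mem_toRight.2 haU
          simp [hU] at this
    have h2 : U.map e ⊆ C ↔ U.toLeft = ∅ := by
      constructor
      · intro hU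
        ext ⟨c, hc⟩
        simp only [Finset.mem_toLeft, Finset.notMem_empty, iff_false]
        exact fun hcU => hd hc (hU (Finset.mem_map_of_mem e hcU))
      · intro hU v hv
        obtain ⟨(⟨a, ha⟩ | ⟨a, ha⟩), haU, rfl⟩ := Finset.mem_map.1 hv
        · have := Finset.mem_toLeft.2 haU
          simp [hU] at this
        · exact ha
    rw [h1, h2]
    refine or_congr (and_congr_right fun hU => ?_) (and_congr_right fun hU => ?_)
    · have : U.toLeft.map (Function.Embedding.subtype _) = U.map e := by
        conv_rhs => rw [← Finset.toLeft_disjSum_toRight (u := U), hU]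
        ext v
        simp [hl, hr]
      rw [restrict, mem_comap, this]
    · have : U.toRight.map (Function.Embedding.subtype _) = U.map e := by
        conv_rhs => rw [← Finset.toLeft_disjSum_toRight (u := U), hU]
        ext v
        simp [hl, hr]
      rw [restrict, mem_comap, this]
  rw [he]
  refine comap_iso_restrict _ _ _ fun w => ?_
  rw [hK]
  simp [hl, hr]

omit [DecidableEq V] in
theorem mem_compRestrict {G : SimpleHypergraph V} {A : List (Finset V)} {U : Finset V} :
    U ∈ (G.compRestrict A).edges ↔ U ∈ G.edges ∧ ∃ P ∈ A, U ⊆ P := by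
  simp [compRestrict]

theorem prod_map_res (G : SimpleHypergraph V) {A : List (Finset V)} {K : Finset V}
    (hA : A ∈ setCompositions K) : (A.map (res G)).prod = res (G.compRestrict A) K := by
  induction A generalizing K with
  | nil => rw [nil_mem_setCompositions.1 hA, res_empty, List.map_nil, List.prod_nil]
  | cons B A ih =>
    obtain ⟨-, hB, hA⟩ := mem_setCompositions_cons.1 hA
    rw [List.map_cons, List.prod_cons, ih hA]
    refine res_mul_res Finset.disjoint_sdiff (fun v => ?_) fun U _ => ?_
    · have := @hB v
      rw [Finset.mem_sdiff]
      tauto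
    · rw [mem_compRestrict, mem_compRestrict, List.exists_mem_cons_iff]
      have : (∃ P ∈ A, U ⊆ P) → U ⊆ K \ B := fun ⟨P, hP, hU⟩ v hv =>
        (mem_iff_of_mem_setCompositions hA v).2 ⟨P, hP, hU hv⟩
      constructor
      · rintro ⟨hU, hUB | hUA⟩
        exacts [Or.inl ⟨hUB, hU⟩, Or.inr ⟨this hUA, hU, hUA⟩]
      · rintro (⟨hUB, hU⟩ | ⟨-, hU, hUA⟩)
        exacts [⟨hU, Or.inl hUB⟩, ⟨hU, Or.inr hUA⟩]

/-- Takeuchi's formula for the antipode. -/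
theorem IsAntipode.apply_res [Fintype V] {S : HypergraphAlgebra →ₗ[ℚ] HypergraphAlgebra}
    (hS : IsAntipode ℚ S) (G : SimpleHypergraph V) (K : Finset V) :
    S (res G K) = ∑ A ∈ setCompositions K, (-1 : ℤ) ^ A.length • res (G.compRestrict A) K := by
  trans ∑ A ∈ setCompositions K, (-1 : ℤ) ^ A.length • (A.map (res G)).prod
  swap
  · exact Finset.sum_congr rfl fun A hA => by rw [prod_map_res G hA]
  refine congrFun (eq_of_sum_powerset_mul (r := res G) (s := fun K => S (res G K))
    (t := fun K => ∑ A ∈ setCompositions K, (-1 : ℤ) ^ A.length • (A.map (res G)).prod)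
    (res_empty G) fun K => ?_) K
  rw [IsAntipode.sum_res hS]
  split_ifs with hK
  · subst hK
    simp [setCompositions_empty, res_empty]
  · rw [← Finset.sum_erase_add _ _ (Finset.empty_mem_powerset K), res_empty, one_mul,
      Finset.sdiff_empty, sum_setCompositions (Finset.nonempty_iff_ne_empty.2 hK),
      ← Finset.sum_add_distrib]
    refine (Finset.sum_eq_zero fun B _ => ?_).symm
    -- The product belonging to `B :: A` occurs twice with opposite signs: in the term `L = B` with
    -- the composition `A` of `K \ B`, and in the term `L = ∅`, where the list is longer by one.
    rw [Finset.mul_sum, ← Finset.sum_add_distrib]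
    refine Finset.sum_eq_zero fun A _ => ?_
    rw [List.length_cons, List.map_cons, List.prod_cons, pow_succ, mul_neg_one, neg_smul,
      mul_smul_comm, add_neg_cancel]

end Takeuchi
end HypergraphAlgebra

/-! ### Flats, orientations and compatible labellings. -/

namespace SimpleHypergraph

section Compatible
variable {n : ℕ} {G F : SimpleHypergraph (Fin n)} {R : Type*} [LinearOrder R]

theorem mem_flats : F ∈ G.flats ↔ ∃ A, IsSetComposition A ∧ F = G.compRestrict A := by
  simp [flats]

theorem contract_mk_eq {U : Finset (Fin n)} (hU : U ∈ F.edges) {a b : Fin n} (ha : a ∈ U)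
    (hb : b ∈ U) : (Quotient.mk F.contractSetoid a) = Quotient.mk F.contractSetoid b :=
  Quotient.sound (Relation.EqvGen.rel _ _ ⟨U, hU, ha, hb⟩)

theorem eq_of_contract_mk_eq {α : Type*} {x : Fin n → α}
    (hx : ∀ U ∈ F.edges, ∀ a ∈ U, ∀ b ∈ U, x a = x b) {a b : Fin n}
    (h : Quotient.mk F.contractSetoid a = Quotient.mk F.contractSetoid b) : x a = x b := by
  have h' : Relation.EqvGen (fun a b => ∃ U ∈ F.edges, a ∈ U ∧ b ∈ U) a b := Quotient.exact h
  clear h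
  induction h' with
  | rel a b h => obtain ⟨U, hU, ha, hb⟩ := h; exact hx U hU a ha b hb
  | refl => rfl
  | symm a b _ ih => exact ih.symm
  | trans _ _ _ _ _ ih1 ih2 => exact ih1.trans ih2

/-- A flat is recovered from its contraction: each part of a defining set composition is a union of
contraction classes, so a hyperedge of `G` inside one class lies inside one part. -/
theorem mem_flat_iff (hF : F ∈ G.flats) {U : Finset (Fin n)} :
    U ∈ F.edges ↔ U ∈ G.edges ∧ ∀ a ∈ U, ∀ b ∈ U,
      Quotient.mk F.contractSetoid a = Quotient.mk F.contractSetoid b := by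
  obtain ⟨A, hA, hFA⟩ := mem_flats.1 hF
  constructor
  · intro hU
    refine ⟨?_, fun a ha b hb => contract_mk_eq hU ha hb⟩
    rw [hFA, HypergraphAlgebra.mem_compRestrict] at hU
    exact hU.1
  · rintro ⟨hU, hc⟩
    obtain ⟨a, ha⟩ := Finset.card_pos.1 (lt_of_lt_of_le two_pos (G.two_le_card U hU))
    obtain ⟨P, hP, haP⟩ := hA.cover a
    rw [hFA, HypergraphAlgebra.mem_compRestrict]
    refine ⟨hU, P, hP, fun b hb => ?_⟩
    -- Membership in `P` is treated as a `Prop`-valued labelling. It is constant on each hyperedge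
    -- of `F`, because the parts are disjoint.
    refine (eq_of_contract_mk_eq (x := fun v => v ∈ P) ?_ (hc a ha b hb)).mp haP
    intro U' hU' c hc d hd
    rw [hFA, HypergraphAlgebra.mem_compRestrict] at hU'
    obtain ⟨-, Q, hQ, hU'Q⟩ := hU'
    by_cases hPQ : Q = P
    · subst hPQ
      exact propext (iff_of_true (hU'Q hc) (hU'Q hd))
    · have := Finset.disjoint_left.1 (hA.pairwise_disjoint.forall hQ hP hPQ)
      exact propext (iff_of_false (this (hU'Q hc)) (this (hU'Q hd)))

theorem mem_contract {W : Finset F.Contracted} :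
    W ∈ (G.contract F).edges ↔
      ∃ U ∈ G.edges, (∀ c, c ∈ W ↔ ∃ a ∈ U, Quotient.mk F.contractSetoid a = c) ∧
        ∃ a ∈ U, ∃ b ∈ U, Quotient.mk F.contractSetoid a ≠ Quotient.mk F.contractSetoid b := by
  classical
  have hcard : ∀ U : Finset (Fin n), (∀ c, c ∈ W ↔ ∃ a ∈ U, Quotient.mk F.contractSetoid a = c) →
      (2 ≤ W.card ↔ ∃ a ∈ U, ∃ b ∈ U,
        Quotient.mk F.contractSetoid a ≠ Quotient.mk F.contractSetoid b) := by
    intro U hU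
    rw [Nat.succ_le_iff, Finset.one_lt_card]
    constructor
    · rintro ⟨c, hc, d, hd, hcd⟩
      obtain ⟨a, ha, rfl⟩ := (hU c).1 hc
      obtain ⟨b, hb, rfl⟩ := (hU d).1 hd
      exact ⟨a, ha, b, hb, hcd⟩
    · rintro ⟨a, ha, b, hb, hab⟩
      exact ⟨_, (hU _).2 ⟨a, ha, rfl⟩, _, (hU _).2 ⟨b, hb, rfl⟩, hab⟩
  simp only [contract, Finset.mem_filter, Finset.mem_image]
  constructor
  · rintro ⟨⟨U, hU, rfl⟩, h2⟩
    exact ⟨U, hU, by simp, (hcard U (by simp)).1 h2⟩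
  · rintro ⟨U, hU, h1, h2⟩
    exact ⟨⟨U, hU, by ext c; simp [h1]⟩, (hcard U h1).2 h2⟩

theorem vertexOf_surjective (O : Orientation (G.contract F)) : Function.Surjective (vertexOf O) := by
  intro x
  obtain ⟨y, rfl⟩ := Quotient.exists_rep x
  obtain ⟨z, rfl⟩ := Quotient.exists_rep y
  exact ⟨z, rfl⟩

theorem vertexOf_eq_of_mk_eq (O : Orientation (G.contract F)) {a b : Fin n}
    (h : Quotient.mk F.contractSetoid a = Quotient.mk F.contractSetoid b) :
    vertexOf O a = vertexOf O b := congrArg (Quotient.mk O.setoid) h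

theorem vertexOf_eq_of_mem_head (O : Orientation (G.contract F)) {U} {a b : Fin n}
    (ha : Quotient.mk F.contractSetoid a ∈ O.head U)
    (hb : Quotient.mk F.contractSetoid b ∈ O.head U) : vertexOf O a = vertexOf O b :=
  Quotient.sound (Relation.EqvGen.rel _ _ ⟨U, ha, hb⟩)

theorem arrow_of_mem_head (O : Orientation (G.contract F)) {U} {a b : Fin n}
    (ha : Quotient.mk F.contractSetoid a ∈ O.head U) (hbU : Quotient.mk F.contractSetoid b ∈ U.1)
    (hb : Quotient.mk F.contractSetoid b ∉ O.head U) : O.Arrow (vertexOf O a) (vertexOf O b) :=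
  ⟨U, _, ha, _, hbU, hb, rfl, rfl⟩

theorem eq_of_vertexOf_eq {α : Type*} (O : Orientation (G.contract F)) {x : Fin n → α}
    (hF : ∀ U ∈ F.edges, ∀ a ∈ U, ∀ b ∈ U, x a = x b)
    (hO : ∀ U a b, Quotient.mk F.contractSetoid a ∈ O.head U →
      Quotient.mk F.contractSetoid b ∈ O.head U → x a = x b) {a b : Fin n}
    (h : vertexOf O a = vertexOf O b) : x a = x b := by
  have h' : Relation.EqvGen (fun a b => ∃ U, a ∈ O.head U ∧ b ∈ O.head U)
    (Quotient.mk F.contractSetoid a) (Quotient.mk F.contractSetoid b) := Quotient.exact h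
  let y : F.Contracted → α := Quotient.lift x fun a b h => eq_of_contract_mk_eq hF (Quotient.sound h)
  have key : ∀ c d, Relation.EqvGen (fun a b => ∃ U, a ∈ O.head U ∧ b ∈ O.head U) c d →
      y c = y d := by
    intro c d hcd
    induction hcd with
    | rel c d h =>
      obtain ⟨U, hc, hd⟩ := h
      obtain ⟨a, rfl⟩ := Quotient.exists_rep c
      obtain ⟨b, rfl⟩ := Quotient.exists_rep d
      exact hO U a b hc hd
    | refl => rfl
    | symm _ _ _ ih => exact ih.symm
    | trans _ _ _ _ _ ih1 ih2 => exact ih1.trans ih2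
  exact key _ _ h'

/-- A labelling of the vertices by a linear order is compatible with an orientation if it is
constant on the vertices of the oriented graph and strictly decreases along the arrows. -/
structure IsCompatible (O : Orientation (G.contract F)) (x : Fin n → R) : Prop where
  eq : ∀ a b, vertexOf O a = vertexOf O b → x a = x b
  lt : ∀ a b, O.Arrow (vertexOf O a) (vertexOf O b) → x b < x a

namespace IsCompatible
variable {O O' : Orientation (G.contract F)} {x : Fin n → R}

theorem acyclic (h : IsCompatible O x) : O.Acyclic := by
  have key : ∀ u v, Relation.TransGen O.Arrow u v →
      ∀ a b, vertexOf O a = u → vertexOf O b = v → x b < x a := by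
    intro u v huv
    induction huv with
    | single h' => rintro a b rfl rfl; exact h.lt a b h'
    | @tail w _ _ h' ih =>
      rintro a b rfl rfl
      obtain ⟨c, rfl⟩ := vertexOf_surjective O w
      exact (h.lt _ _ h').trans (ih a c rfl rfl)
  intro u hu
  obtain ⟨a, rfl⟩ := vertexOf_surjective O u
  exact lt_irrefl _ (key _ _ hu a a rfl rfl)

/-- The labelling is constant on a head and strictly smaller on the rest of the hyperedge. This
forces the head to be the locus of the maximum, so `x` determines `O`. -/
theorem mem_head_iff (h : IsCompatible O x) (U : {U // U ∈ (G.contract F).edges}) (a : Fin n) :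
    Quotient.mk F.contractSetoid a ∈ O.head U ↔ Quotient.mk F.contractSetoid a ∈ U.1 ∧
      ∀ b, Quotient.mk F.contractSetoid b ∈ U.1 → x b ≤ x a := by
  constructor
  · intro ha
    refine ⟨(O.head_ssubset U).1 ha, fun b hb => ?_⟩
    by_cases hb' : Quotient.mk F.contractSetoid b ∈ O.head U
    · exact (h.eq _ _ (vertexOf_eq_of_mem_head O hb' ha)).le
    · exact (h.lt _ _ (arrow_of_mem_head O ha hb hb')).le
  · rintro ⟨haU, ha⟩
    by_contra ha'
    obtain ⟨c, hc⟩ := O.head_nonempty U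
    obtain ⟨b, rfl⟩ := Quotient.exists_rep c
    exact absurd (h.lt _ _ (arrow_of_mem_head O hc haU ha')) (ha b ((O.head_ssubset U).1 hc)).not_gt

theorem unique (h : IsCompatible O x) (h' : IsCompatible O' x) : O = O' := by
  refine Orientation.ext (funext fun U => Finset.ext fun c => ?_)
  obtain ⟨a, rfl⟩ := Quotient.exists_rep c
  exact (h.mem_head_iff U a).trans (h'.mem_head_iff U a).symm

/-- The labelling determines the flat as well: a hyperedge that is not contracted has an arrow
leaving its head, and the label drops along it. -/
theorem mem_flat_iff (h : IsCompatible O x) (hF : F ∈ G.flats) {U : Finset (Fin n)} :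
    U ∈ F.edges ↔ U ∈ G.edges ∧ ∀ a ∈ U, ∀ b ∈ U, x a = x b := by
  rw [SimpleHypergraph.mem_flat_iff hF]
  refine and_congr_right fun hU => ⟨fun hc a ha b hb =>
    h.eq _ _ (vertexOf_eq_of_mk_eq O (hc a ha b hb)), fun hc => ?_⟩
  by_contra hn
  push Not at hn
  classical
  have hmem : U.image (Quotient.mk F.contractSetoid) ∈ (G.contract F).edges :=
    mem_contract.2 ⟨U, hU, by simp, hn⟩
  obtain ⟨c, hcU, hc'⟩ := Finset.exists_of_ssubset (O.head_ssubset ⟨_, hmem⟩)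
  obtain ⟨d, hd⟩ := O.head_nonempty ⟨_, hmem⟩
  obtain ⟨b, hb, rfl⟩ := Finset.mem_image.1 hcU
  obtain ⟨a, ha, rfl⟩ := Finset.mem_image.1 ((O.head_ssubset ⟨_, hmem⟩).1 hd)
  have := h.lt _ _ (arrow_of_mem_head O hd hcU hc')
  rw [hc a ha b hb] at this
  exact lt_irrefl _ this

end IsCompatible

open scoped Classical in
theorem exists_isCompatible (x : Fin n → R)
    (hF : ∀ U, U ∈ F.edges ↔ U ∈ G.edges ∧ ∀ a ∈ U, ∀ b ∈ U, x a = x b) :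
    ∃ O : Orientation (G.contract F), IsCompatible O x := by
  have hx : ∀ U ∈ F.edges, ∀ a ∈ U, ∀ b ∈ U, x a = x b := fun U hU => ((hF U).1 hU).2
  let y : F.Contracted → R := Quotient.lift x fun a b h => eq_of_contract_mk_eq hx (Quotient.sound h)
  have hy : ∀ a, y (Quotient.mk F.contractSetoid a) = x a := fun _ => rfl
  let O : Orientation (G.contract F) :=
    { head := fun U => U.1.filter fun c => ∀ d ∈ U.1, y d ≤ y c
      head_nonempty := fun U => by
        obtain ⟨c, hc, h⟩ := U.1.exists_max_image y
          (Finset.card_pos.1 (lt_of_lt_of_le two_pos ((G.contract F).two_le_card _ U.2)))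
        exact ⟨c, Finset.mem_filter.2 ⟨hc, h⟩⟩
      head_ssubset := fun U => by
        refine (Finset.filter_subset _ _).ssubset_of_ne fun h => ?_
        obtain ⟨W, hW, hWU, a, ha, b, hb, hab⟩ := mem_contract.1 U.2
        -- If the head were the whole hyperedge, `x` would be constant on its lift `W`, which would
        -- then belong to `F` and be contracted.
        refine hab (contract_mk_eq ((hF W).2 ⟨hW, ?_⟩) ha hb)
        have hle : ∀ c ∈ W, ∀ d ∈ W, x c ≤ x d := by
          intro c hc d hd
          have hd' := (hWU _).2 ⟨d, hd, rfl⟩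
          have hc' := (hWU _).2 ⟨c, hc, rfl⟩
          rw [← h] at hd'
          exact (Finset.mem_filter.1 hd').2 _ hc'
        exact fun c hc d hd => (hle c hc d hd).antisymm (hle d hd c hc) }
  have hO : ∀ U c, c ∈ O.head U ↔ c ∈ U.1 ∧ ∀ d ∈ U.1, y d ≤ y c := fun U c => Finset.mem_filter
  have heq : ∀ a b, vertexOf O a = vertexOf O b → x a = x b := fun a b => eq_of_vertexOf_eq O hx
    fun U c d hc hd => (((hO _ _).1 hd).2 _ ((hO _ _).1 hc).1).antisymm
      (((hO _ _).1 hc).2 _ ((hO _ _).1 hd).1)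
  refine ⟨O, heq, ?_⟩
  rintro a b ⟨U, c, hc, d, hdU, hd, hac, hbd⟩
  obtain ⟨c, rfl⟩ := Quotient.exists_rep c
  obtain ⟨d, rfl⟩ := Quotient.exists_rep d
  rw [heq a c hac, heq b d hbd]
  by_contra hle
  -- An element outside the head with a label at least the maximum would itself be in the head.
  refine hd ((hO _ _).2 ⟨hdU, fun e he => (((hO _ _).1 hc).2 e he).trans ?_⟩)
  exact not_lt.1 hle

theorem exists_isCompatible_real {O : Orientation (G.contract F)} (h : O.Acyclic) :
    ∃ x : Fin n → ℝ, IsCompatible O x := by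
  classical
  let _ : Fintype O.Vertex := Fintype.ofFinite _
  -- The label is the number of vertices reachable by a nonempty path. Along an arrow to `b` it
  -- drops strictly, because acyclicity keeps `b` from reaching itself.
  refine ⟨fun a => ((Finset.univ.filter fun v =>
    Relation.TransGen O.Arrow (vertexOf O a) v).card : ℝ), fun a b hab => by rw [hab], ?_⟩
  intro a b hab
  rw [Nat.cast_lt]
  refine Finset.card_lt_card ⟨fun v hv => ?_, fun hs => ?_⟩
  · rw [Finset.mem_filter] at hv ⊢
    exact ⟨hv.1, Relation.TransGen.head hab hv.2⟩
  · have := @hs (vertexOf O b) (by simpa using Relation.TransGen.single hab)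
    exact h _ (by simpa using this)

theorem length_psi {O : Orientation (G.contract F)} (h : O.Acyclic) :
    (psi O).length = Nat.card O.Vertex := by
  rw [psi, List.length_map]
  exact (length_sourceOrder h _ _).trans (@Nat.card_eq_fintype_card _ (Fintype.ofFinite _)).symm

theorem antipodeCoeff_eq_sum (G F : SimpleHypergraph (Fin n)) :
    G.antipodeCoeff F = ∑ O : AcyclicOrientation (G.contract F), (-1) ^ Nat.card O.1.Vertex :=
  Finset.sum_congr rfl fun O _ => by rw [length_psi O.2]

/-- Positions increase along arrows while compatible labels decrease, hence the order dual. -/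
theorem isCompatible_toDual_iff {O : Orientation (G.contract F)} {A : List (Finset (Fin n))} :
    IsCompatible O (fun v => OrderDual.toDual (partIndex A v)) ↔
      IsLayering (vertexOf O) O.Arrow Finset.univ A := by
  constructor
  · intro h
    exact ⟨fun a _ b _ hab => h.eq a b hab, fun a _ b _ hab => h.lt a b hab⟩
  · intro h
    exact ⟨fun a b hab => h.1 a (Finset.mem_univ _) b (Finset.mem_univ _) hab,
      fun a b hab => h.2 a (Finset.mem_univ _) b (Finset.mem_univ _) hab⟩

open scoped Classical in
theorem sum_isCompatible (O : AcyclicOrientation (G.contract F)) :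
    ∑ A ∈ setCompositions (Finset.univ : Finset (Fin n)),
      (if IsCompatible O.1 (fun v => OrderDual.toDual (partIndex A v)) then (-1 : ℤ) ^ A.length
        else 0) = (-1) ^ Nat.card O.1.Vertex := by
  let _ : Fintype O.1.Vertex := Fintype.ofFinite _
  have hu : preim (vertexOf O.1) Finset.univ = Finset.univ := by ext; simp [mem_preim]
  have := sum_isLayering (vertexOf_surjective O.1) O.2 Finset.univ
  rw [hu, Finset.card_univ, ← Nat.card_eq_fintype_card, Finset.sum_filter] at this
  rw [← this]
  refine Finset.sum_congr (by congr!) fun A _ => ?_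
  simp only [isCompatible_toDual_iff]

end Compatible

end SimpleHypergraph

/-! ### The antipode formula. -/

namespace HypergraphAlgebra
open SimpleHypergraph

open scoped Classical in
-- The double sum has one nonzero term: the position function of `A` fixes the flat, which is
-- `G|_A`, and the acyclic orientation. In this form the sums over `A` and over `(F, O)` can be
-- exchanged in Takeuchi's formula.
theorem res_compRestrict_eq_sum {n : ℕ} (G : SimpleHypergraph (Fin n)) {A : List (Finset (Fin n))}
    (hA : A ∈ setCompositions Finset.univ) :
    res (G.compRestrict A) Finset.univ = ∑ F ∈ G.flats, ∑ O : AcyclicOrientation (G.contract F),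
      if IsCompatible O.1 (fun v => OrderDual.toDual (partIndex A v)) then cls F else 0 := by
  have hmem : ∀ U, U ∈ (G.compRestrict A).edges ↔ U ∈ G.edges ∧ ∀ a ∈ U, ∀ b ∈ U,
      OrderDual.toDual (partIndex A a) = OrderDual.toDual (partIndex A b) := by
    intro U
    rw [mem_compRestrict]
    refine and_congr_right fun hU => ?_
    rw [exists_part_iff hA (Finset.subset_univ U)
      (Finset.card_pos.1 (lt_of_lt_of_le two_pos (G.two_le_card U hU)))]
    rfl
  have hflat : G.compRestrict A ∈ G.flats := mem_flats.2 ⟨A, isSetComposition_of_mem hA, rfl⟩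
  obtain ⟨O, hO⟩ := exists_isCompatible _ hmem
  rw [Finset.sum_eq_single_of_mem _ hflat, Fintype.sum_eq_single ⟨O, hO.acyclic⟩, if_pos hO, res_univ,
    HypergraphClass.of_fin]
  · rfl
  · exact fun O' h => if_neg fun h' => h (Subtype.ext (h'.unique hO))
  · refine fun F hF h => Finset.sum_eq_zero fun O' _ => if_neg fun h' => h ?_
    ext U
    rw [hmem, h'.mem_flat_iff hF]

theorem IsAntipode.apply_cls {n : ℕ} {S : HypergraphAlgebra →ₗ[ℚ] HypergraphAlgebra}
    (hS : IsAntipode ℚ S) (G : SimpleHypergraph (Fin n)) :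
    S (cls G) = ∑ F ∈ G.flats, (G.antipodeCoeff F : ℚ) • cls F := by
  classical
  have : cls G = res G Finset.univ := by rw [res_univ, HypergraphClass.of_fin]; rfl
  rw [this, IsAntipode.apply_res hS]
  rw [Finset.sum_congr rfl fun A hA => by rw [res_compRestrict_eq_sum G hA, Finset.smul_sum],
    Finset.sum_comm]
  refine Finset.sum_congr rfl fun F _ => ?_
  simp_rw [Finset.smul_sum]
  rw [Finset.sum_comm, antipodeCoeff_eq_sum, Int.cast_smul_eq_zsmul, Finset.sum_smul]
  refine Finset.sum_congr rfl fun O _ => ?_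
  rw [← sum_isCompatible O, Finset.sum_smul]
  refine Finset.sum_congr rfl fun A _ => ?_
  split_ifs <;> simp

end HypergraphAlgebra

/-! ### Faces of the hypergraphic polytope and their normal cones. -/

namespace SimpleHypergraph

section Faces
variable {n : ℕ}

theorem le_dotProduct_of_mem_simplex {U : Finset (Fin n)} {y : Fin n → ℝ} {m : ℝ}
    (h : ∀ i ∈ U, m ≤ y i) {p : Fin n → ℝ} (hp : p ∈ simplex U) : m ≤ y ⬝ᵥ p := by
  refine convexHull_min (t := {p | m ≤ y ⬝ᵥ p}) ?_
    (convex_halfSpace_ge ⟨dotProduct_add y, fun c => dotProduct_smul c y⟩ m) hp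
  rintro _ ⟨i, hi, rfl⟩
  simpa using h i hi

theorem dotProduct_le_of_mem_simplex {U : Finset (Fin n)} {y : Fin n → ℝ} {m : ℝ}
    (h : ∀ i ∈ U, y i ≤ m) {p : Fin n → ℝ} (hp : p ∈ simplex U) : y ⬝ᵥ p ≤ m := by
  have := le_dotProduct_of_mem_simplex (y := -y) (m := -m) (fun i hi => neg_le_neg (h i hi)) hp
  rwa [neg_dotProduct, neg_le_neg_iff] at this

/-- The elements of `U` at which `x` is maximal. -/
def argmax (x : Fin n → ℝ) (U : Finset (Fin n)) : Finset (Fin n) :=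
  U.filter fun a => ∀ b ∈ U, x b ≤ x a

theorem mem_argmax {x : Fin n → ℝ} {U : Finset (Fin n)} {a : Fin n} :
    a ∈ argmax x U ↔ a ∈ U ∧ ∀ b ∈ U, x b ≤ x a := Finset.mem_filter

/-- For large `K` the functional `y - K • x` is minimal on `U` at `a`. As `x ⬝ᵥ p = x a`, this gives
`y a ≤ y ⬝ᵥ p`; the same for `-y` gives equality. No barycentric coordinates of `p` are needed. -/
theorem dotProduct_eq_of_mem_simplex {U : Finset (Fin n)} {x y : Fin n → ℝ} {a : Fin n}
    (ha : a ∈ argmax x U) (hy : ∀ b ∈ argmax x U, y b = y a) {p : Fin n → ℝ} (hp : p ∈ simplex U)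
    (hxp : x ⬝ᵥ p = x a) : y ⬝ᵥ p = y a := by
  have key : ∀ y : Fin n → ℝ, (∀ b ∈ argmax x U, y b = y a) → y a ≤ y ⬝ᵥ p := by
    intro y hy
    -- Only the quotients with `x b < x a` matter; when `x b = x a` the denominator vanishes and the
    -- value `0` is not used.
    obtain ⟨K, hK⟩ := (U.image fun b => (y a - y b) / (x a - x b)).exists_le
    have := le_dotProduct_of_mem_simplex (y := y - K • x) (m := y a - K * x a) (fun b hb => ?_) hp
    · rw [sub_dotProduct, smul_dotProduct, hxp, smul_eq_mul] at this
      linarith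
    · obtain h | h := ((mem_argmax.1 ha).2 b hb).eq_or_lt
      · have hb' : b ∈ argmax x U := mem_argmax.2 ⟨hb, by rw [h]; exact (mem_argmax.1 ha).2⟩
        rw [Pi.sub_apply, Pi.smul_apply, smul_eq_mul, hy b hb', h]
      · have := hK _ (Finset.mem_image_of_mem _ hb)
        rw [div_le_iff₀ (sub_pos.2 h)] at this
        rw [Pi.sub_apply, Pi.smul_apply, smul_eq_mul]
        linarith
  refine le_antisymm ?_ (key y hy)
  have := key (-y) fun b hb => congrArg Neg.neg (hy b hb)
  rwa [neg_dotProduct, Pi.neg_apply, neg_le_neg_iff] at this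

variable {G : SimpleHypergraph (Fin n)}

theorem mem_polytope {p : Fin n → ℝ} : p ∈ G.polytope ↔
    ∃ g : G.edges → Fin n → ℝ, (∀ U, g U ∈ simplex U.1) ∧ ∑ U, g U = p := by
  rw [polytope, ← Finset.sum_coe_sort, Set.mem_fintype_sum]
  simp

theorem convex_polytope (G : SimpleHypergraph (Fin n)) : Convex ℝ G.polytope :=
  convex_sum _ fun _ _ => convex_convexHull _ _

theorem sum_single_mem_polytope {c : G.edges → Fin n} (hc : ∀ U, c U ∈ U.1) :
    ∑ U, Pi.single (c U) (1 : ℝ) ∈ G.polytope :=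
  mem_polytope.2 ⟨_, fun U => subset_convexHull _ _ ⟨c U, hc U, rfl⟩, rfl⟩

theorem dotProduct_sum_single (y : Fin n → ℝ) (c : G.edges → Fin n) :
    y ⬝ᵥ ∑ U, Pi.single (c U) (1 : ℝ) = ∑ U, y (c U) := by
  simp [dotProduct_sum]

/-- The points of the polytope at which the functional `x` is maximal. -/
def maxFace (G : SimpleHypergraph (Fin n)) (x : Fin n → ℝ) : Set (Fin n → ℝ) :=
  {p ∈ G.polytope | ∀ q ∈ G.polytope, x ⬝ᵥ q ≤ x ⬝ᵥ p}

theorem exists_argmax (G : SimpleHypergraph (Fin n)) (x : Fin n → ℝ) :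
    ∃ c : G.edges → Fin n, ∀ U, c U ∈ argmax x U.1 := by
  have : ∀ U : G.edges, ∃ a, a ∈ argmax x U.1 := fun U => by
    obtain ⟨a, ha, h⟩ := U.1.exists_max_image x
      (Finset.card_pos.1 (lt_of_lt_of_le two_pos (G.two_le_card U.1 U.2)))
    exact ⟨a, mem_argmax.2 ⟨ha, h⟩⟩
  choose c hc using this
  exact ⟨c, hc⟩

theorem dotProduct_le_sum_argmax {x : Fin n → ℝ} {c : G.edges → Fin n}
    (hc : ∀ U, c U ∈ argmax x U.1) {p : Fin n → ℝ} (hp : p ∈ G.polytope) :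
    x ⬝ᵥ p ≤ ∑ U, x (c U) := by
  obtain ⟨g, hg, rfl⟩ := mem_polytope.1 hp
  rw [dotProduct_sum]
  exact Finset.sum_le_sum fun U _ =>
    dotProduct_le_of_mem_simplex (mem_argmax.1 (hc U)).2 (hg U)

theorem mem_maxFace_iff {x : Fin n → ℝ} {c : G.edges → Fin n} (hc : ∀ U, c U ∈ argmax x U.1)
    {p : Fin n → ℝ} : p ∈ G.maxFace x ↔ p ∈ G.polytope ∧ x ⬝ᵥ p = ∑ U, x (c U) := by
  refine and_congr_right fun hp => ⟨fun h => ?_, fun h q hq => ?_⟩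
  · refine (dotProduct_le_sum_argmax hc hp).antisymm ?_
    rw [← dotProduct_sum_single]
    exact h _ (sum_single_mem_polytope fun U => (mem_argmax.1 (hc U)).1)
  · rw [h]
    exact dotProduct_le_sum_argmax hc hq

theorem sum_single_mem_maxFace {x : Fin n → ℝ} {c : G.edges → Fin n}
    (hc : ∀ U, c U ∈ argmax x U.1) : ∑ U, Pi.single (c U) (1 : ℝ) ∈ G.maxFace x :=
  (mem_maxFace_iff hc).2 ⟨sum_single_mem_polytope fun U => (mem_argmax.1 (hc U)).1,
    dotProduct_sum_single x c⟩

/-- A point of a Minkowski sum maximises `x` only if each summand does, which reduces the claim to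
single simplices. -/
theorem dotProduct_eq_of_mem_maxFace {x y : Fin n → ℝ} {c : G.edges → Fin n}
    (hc : ∀ U, c U ∈ argmax x U.1) (hy : ∀ U : G.edges, ∀ b ∈ argmax x U.1, y b = y (c U))
    {p : Fin n → ℝ} (hp : p ∈ G.maxFace x) : y ⬝ᵥ p = ∑ U, y (c U) := by
  obtain ⟨hp, hx⟩ := (mem_maxFace_iff hc).1 hp
  obtain ⟨g, hg, rfl⟩ := mem_polytope.1 hp
  rw [dotProduct_sum] at hx ⊢
  rw [Finset.sum_eq_sum_iff_of_le fun U _ =>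
    dotProduct_le_of_mem_simplex (mem_argmax.1 (hc U)).2 (hg U)] at hx
  exact Finset.sum_congr rfl fun U hU =>
    dotProduct_eq_of_mem_simplex (hc U) (hy U) (hg U) (hx U hU)

theorem sum_update_sub {α : Type*} [DecidableEq G.edges] (y : α → ℝ) (c : G.edges → α)
    (U : G.edges) (a b : α) :
    ∑ V, y (Function.update c U a V) - ∑ V, y (Function.update c U b V) = y a - y b := by
  rw [← Finset.sum_sub_distrib, Fintype.sum_eq_single U]
  · simp
  · intro V hV
    simp [hV]

theorem update_mem_argmax [DecidableEq G.edges] {x : Fin n → ℝ} {c : G.edges → Fin n}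
    (hc : ∀ U, c U ∈ argmax x U.1) {U : G.edges} {a : Fin n} (ha : a ∈ argmax x U.1) (V : G.edges) :
    Function.update c U a V ∈ argmax x V.1 := by
  by_cases h : V = U
  · subst h; simpa using ha
  · simpa [h] using hc V

/-- Two sums of basis vectors that differ in the choice on one hyperedge isolate the inequality for
that hyperedge. Conversely, the inequalities say that `y` is maximal wherever `x` is, so `y` has its
maximal value on the whole face. -/
theorem normalCone_maxFace (G : SimpleHypergraph (Fin n)) (x : Fin n → ℝ) :
    normalCone G.polytope (G.maxFace x) =
      {y | ∀ U ∈ G.edges, ∀ a ∈ argmax x U, ∀ b ∈ U, y b ≤ y a} := by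
  classical
  obtain ⟨c, hc⟩ := exists_argmax G x
  ext y
  constructor
  · intro hy U hU a ha b hb
    have hb' : ∀ V, Function.update c ⟨U, hU⟩ b V ∈ V.1 := by
      intro V
      by_cases h : V = ⟨U, hU⟩
      · subst h; simpa using hb
      · simpa [h] using (mem_argmax.1 (hc V)).1
    have := hy _ (sum_single_mem_maxFace (update_mem_argmax hc (U := ⟨U, hU⟩) ha)) _
      (sum_single_mem_polytope hb')
    rw [dotProduct_sum_single, dotProduct_sum_single] at this
    linarith [sum_update_sub y c ⟨U, hU⟩ a b]
  · intro hy p hp q hq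
    have hcy : ∀ U, c U ∈ argmax y U.1 := fun U =>
      mem_argmax.2 ⟨(mem_argmax.1 (hc U)).1, hy U.1 U.2 _ (hc U)⟩
    rw [dotProduct_eq_of_mem_maxFace hc (fun U b hb => ?_) hp]
    · exact dotProduct_le_sum_argmax hcy hq
    · exact (hy U.1 U.2 _ (hc U) b (mem_argmax.1 hb).1).antisymm
        (hy U.1 U.2 _ hb _ (mem_argmax.1 (hc U)).1)

theorem maxFace_nonempty (G : SimpleHypergraph (Fin n)) (x : Fin n → ℝ) : (G.maxFace x).Nonempty :=
  ⟨_, sum_single_mem_maxFace (exists_argmax G x).choose_spec⟩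

theorem isFace_maxFace (G : SimpleHypergraph (Fin n)) (x : Fin n → ℝ) :
    IsFace G.polytope (G.maxFace x) :=
  ⟨maxFace_nonempty G x, fun _ =>
    ⟨LinearMap.toContinuousLinearMap (dotProductEquiv ℝ (Fin n) x), rfl⟩⟩

end Faces

end SimpleHypergraph

/-! ### Faces, normal cones and relative interiors in general. -/

section Faces
variable {n : ℕ} {P f g : Set (Fin n → ℝ)}

theorem IsFace.exists_eq (hf : IsFace P f) :
    ∃ z : Fin n → ℝ, f = {p ∈ P | ∀ q ∈ P, z ⬝ᵥ q ≤ z ⬝ᵥ p} := by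
  obtain ⟨l, hl⟩ := hf.2 hf.1
  refine ⟨(dotProductEquiv ℝ (Fin n)).symm l.toLinearMap, ?_⟩
  have : ∀ q, (dotProductEquiv ℝ (Fin n)).symm l.toLinearMap ⬝ᵥ q = l q := fun q =>
    DFunLike.congr_fun ((dotProductEquiv ℝ (Fin n)).apply_symm_apply l.toLinearMap) q
  simp only [this]
  exact hl

/-- A face is recovered from its normal cone as the set of points of `P` that maximise every
functional in the cone; the functional exposing the face is one of them. -/
theorem IsFace.eq_of_normalCone_eq (hf : IsFace P f) (hg : IsFace P g)
    (h : normalCone P f = normalCone P g) : f = g := by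
  have key : ∀ f, IsFace P f → f = {p ∈ P | ∀ z ∈ normalCone P f, ∀ q ∈ P, z ⬝ᵥ q ≤ z ⬝ᵥ p} := by
    intro f hf
    obtain ⟨z, hz⟩ := hf.exists_eq
    have hzf : z ∈ normalCone P f := fun p hp => by
      rw [hz] at hp
      exact hp.2
    refine Set.Subset.antisymm (fun p hp => ⟨?_, fun z hz => hz p hp⟩) fun p hp => ?_
    · rw [hz] at hp
      exact hp.1
    · rw [hz]
      exact ⟨hp.1, hp.2 z hzf⟩
  rw [key f hf, key g hg, h]

theorem exists_lineMap_neg_mem_of_mem_intrinsicInterior {p q : Fin n → ℝ}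
    (hp : p ∈ intrinsicInterior ℝ f) (hq : q ∈ f) : ∃ t < (0 : ℝ), AffineMap.lineMap p q t ∈ f := by
  obtain ⟨y, hy, rfl⟩ := mem_intrinsicInterior.1 hp
  let φ : ℝ → affineSpan ℝ f := fun t =>
    ⟨AffineMap.lineMap y.1 q t, AffineMap.lineMap_mem t y.2 (subset_affineSpan ℝ f hq)⟩
  have hφ : Continuous φ := Continuous.subtype_mk AffineMap.lineMap_continuous _
  have h0 : φ 0 = y := Subtype.ext (AffineMap.lineMap_apply_zero _ _)
  have hmem : φ ⁻¹' ((↑) ⁻¹' f) ∈ nhds (0 : ℝ) :=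
    hφ.continuousAt (by rw [h0]; exact mem_interior_iff_mem_nhds.1 hy)
  obtain ⟨ε, hε, hball⟩ := Metric.mem_nhds_iff.1 hmem
  refine ⟨-(ε / 2), by linarith, hball (show -(ε / 2) ∈ Metric.ball 0 ε from ?_)⟩
  rw [Metric.mem_ball, dist_zero_right, norm_neg, Real.norm_of_nonneg (by linarith)]
  linarith

theorem IsFace.subset_of_mem_intrinsicInterior (hf : IsFace P f) (hg : IsFace P g) {p : Fin n → ℝ}
    (hpf : p ∈ intrinsicInterior ℝ f) (hpg : p ∈ g) : f ⊆ g := by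
  have hfP : f ⊆ P := by
    obtain ⟨z, hz⟩ := hf.exists_eq
    rw [hz]
    exact fun p hp => hp.1
  obtain ⟨z, rfl⟩ := hg.exists_eq
  intro q hq
  obtain ⟨t, ht, hmem⟩ := exists_lineMap_neg_mem_of_mem_intrinsicInterior hpf hq
  refine ⟨hfP hq, fun r hr => (hpg.2 r hr).trans ?_⟩
  -- The segment from `q` to `p` continues a little beyond `p` inside `f`. If `z` were smaller at
  -- `q` than at `p`, it would exceed its maximum there.
  have := hpg.2 _ (hfP hmem)
  rw [AffineMap.lineMap_apply, vsub_eq_sub, vadd_eq_add, dotProduct_add, dotProduct_smul,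
    dotProduct_sub, smul_eq_mul] at this
  by_contra hlt
  nlinarith

theorem IsFace.eq_of_mem_intrinsicInterior (hf : IsFace P f) (hg : IsFace P g) {p : Fin n → ℝ}
    (hpf : p ∈ intrinsicInterior ℝ f) (hpg : p ∈ intrinsicInterior ℝ g) : f = g :=
  (hf.subset_of_mem_intrinsicInterior hg hpf (intrinsicInterior_subset hpg)).antisymm
    (hg.subset_of_mem_intrinsicInterior hf hpg (intrinsicInterior_subset hpf))

end Faces

/-! ### The face indexed by an acyclic orientation and the Euler characteristic. -/

namespace SimpleHypergraph

section Orientation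
variable {n : ℕ} {G F : SimpleHypergraph (Fin n)} {O O' : Orientation (G.contract F)}
  {x y : Fin n → ℝ}

theorem IsCompatible.vertexOf_eq_or_arrow (h : IsCompatible O x) (hF : F ∈ G.flats)
    {U : Finset (Fin n)} (hU : U ∈ G.edges) {a b : Fin n} (ha : a ∈ argmax x U) (hb : b ∈ U) :
    vertexOf O a = vertexOf O b ∨ O.Arrow (vertexOf O a) (vertexOf O b) := by
  rw [mem_argmax] at ha
  by_cases hUF : U ∈ F.edges
  · exact Or.inl (vertexOf_eq_of_mk_eq O (contract_mk_eq hUF ha.1 hb))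
  classical
  rw [SimpleHypergraph.mem_flat_iff hF, not_and] at hUF
  have hn := hUF hU
  push Not at hn
  have hmem : U.image (Quotient.mk F.contractSetoid) ∈ (G.contract F).edges :=
    mem_contract.2 ⟨U, hU, by simp, hn⟩
  have hah : Quotient.mk F.contractSetoid a ∈ O.head ⟨_, hmem⟩ := by
    refine (h.mem_head_iff _ a).2 ⟨Finset.mem_image_of_mem _ ha.1, fun d hd => ?_⟩
    obtain ⟨e, he, hed⟩ := Finset.mem_image.1 hd
    rw [← h.eq _ _ (vertexOf_eq_of_mk_eq O hed)]
    exact ha.2 e he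
  have hbU := Finset.mem_image_of_mem (Quotient.mk F.contractSetoid) hb
  by_cases hbh : Quotient.mk F.contractSetoid b ∈ O.head ⟨_, hmem⟩
  · exact Or.inl (vertexOf_eq_of_mem_head O hah hbh)
  · exact Or.inr (arrow_of_mem_head O hah hbU hbh)

theorem IsCompatible.vertexOf_eq_of_mem_argmax (h : IsCompatible O x) (hF : F ∈ G.flats)
    {U : Finset (Fin n)} (hU : U ∈ G.edges) {a b : Fin n} (ha : a ∈ argmax x U)
    (hb : b ∈ argmax x U) : vertexOf O a = vertexOf O b := by
  refine (h.vertexOf_eq_or_arrow hF hU ha (mem_argmax.1 hb).1).resolve_right fun hab => ?_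
  exact absurd (h.lt _ _ hab) ((mem_argmax.1 hb).2 _ (mem_argmax.1 ha).1).not_gt

/-- Lifts a hyperedge of `G/F` to one of `G` in such a way that its head lifts into the maximal
locus of `x`. -/
theorem IsCompatible.exists_argmax_of_mem_head (h : IsCompatible O x)
    (U : {U // U ∈ (G.contract F).edges}) :
    ∃ W ∈ G.edges, (∀ a, Quotient.mk F.contractSetoid a ∈ O.head U →
      ∃ a' ∈ argmax x W, Quotient.mk F.contractSetoid a' = Quotient.mk F.contractSetoid a) ∧
      ∀ b, Quotient.mk F.contractSetoid b ∈ U.1 →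
        ∃ b' ∈ W, Quotient.mk F.contractSetoid b' = Quotient.mk F.contractSetoid b := by
  obtain ⟨W, hW, hWU, -⟩ := mem_contract.1 U.2
  refine ⟨W, hW, fun a ha => ?_, fun b hb => (hWU _).1 hb⟩
  obtain ⟨a', ha', haa'⟩ := (hWU _).1 ((O.head_ssubset U).1 ha)
  rw [h.mem_head_iff] at ha
  refine ⟨a', mem_argmax.2 ⟨ha', fun b hb => ?_⟩, haa'⟩
  rw [h.eq _ _ (vertexOf_eq_of_mk_eq O haa')]
  exact ha.2 b ((hWU _).2 ⟨b, hb, rfl⟩)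

/-- A function is constant on the vertices of the oriented graph if it is constant on the set of
maxima of `x` on every hyperedge. -/
theorem IsCompatible.eq_of_eq_on_argmax (h : IsCompatible O x) (hF : F ∈ G.flats)
    (hy : ∀ U ∈ G.edges, ∀ a ∈ argmax x U, ∀ b ∈ argmax x U, y a = y b) {a b : Fin n}
    (hab : vertexOf O a = vertexOf O b) : y a = y b := by
  -- On a hyperedge of `F` the function `x` is constant, so all of it is the maximal locus.
  have hFy : ∀ U ∈ F.edges, ∀ a ∈ U, ∀ b ∈ U, y a = y b := by
    intro U hU a ha b hb
    obtain ⟨hUG, hx⟩ := (h.mem_flat_iff hF).1 hU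
    exact hy U hUG a (mem_argmax.2 ⟨ha, fun c hc => (hx c hc a ha).le⟩) b
      (mem_argmax.2 ⟨hb, fun c hc => (hx c hc b hb).le⟩)
  refine eq_of_vertexOf_eq O hFy (fun U c d hc hd => ?_) hab
  obtain ⟨W, hW, hW', -⟩ := h.exists_argmax_of_mem_head U
  obtain ⟨c', hc', hcc⟩ := hW' c hc
  obtain ⟨d', hd', hdd⟩ := hW' d hd
  rw [← eq_of_contract_mk_eq hFy hcc, ← eq_of_contract_mk_eq hFy hdd]
  exact hy W hW _ hc' _ hd'

theorem IsCompatible.normalCone_maxFace (h : IsCompatible O x) (hF : F ∈ G.flats) :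
    normalCone G.polytope (G.maxFace x) = orientationCone O := by
  rw [SimpleHypergraph.normalCone_maxFace]
  ext y
  constructor
  · intro hy
    have heq : ∀ a b, vertexOf O a = vertexOf O b → y a = y b := fun a b =>
      h.eq_of_eq_on_argmax hF fun U hU a ha b hb =>
        (hy U hU b hb a (mem_argmax.1 ha).1).antisymm (hy U hU a ha b (mem_argmax.1 hb).1)
    refine ⟨heq, ?_⟩
    rintro a b ⟨U, c, hc, d, hdU, -, hac, hbd⟩
    obtain ⟨c, rfl⟩ := Quotient.exists_rep c
    obtain ⟨d, rfl⟩ := Quotient.exists_rep d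
    obtain ⟨W, hW, hW1, hW2⟩ := h.exists_argmax_of_mem_head U
    obtain ⟨c', hc', hcc⟩ := hW1 c hc
    obtain ⟨d', hd', hdd⟩ := hW2 d hdU
    rw [heq a c hac, heq b d hbd, ← heq _ _ (vertexOf_eq_of_mk_eq O hcc),
      ← heq _ _ (vertexOf_eq_of_mk_eq O hdd)]
    exact hy W hW _ hc' _ hd'
  · intro hy U hU a ha b hb
    obtain hab | hab := h.vertexOf_eq_or_arrow hF hU ha hb
    · exact (hy.1 _ _ hab).ge
    · exact hy.2 _ _ hab

theorem IsCompatible.isIndexedBy (h : IsCompatible O x) (hF : F ∈ G.flats) :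
    IsIndexedBy (G.maxFace x) O :=
  ⟨isFace_maxFace G x, h.normalCone_maxFace hF⟩

theorem IsCompatible.mem_orientationCone (h : IsCompatible O x) : x ∈ orientationCone O :=
  ⟨h.eq, fun a b hab => (h.lt a b hab).le⟩

theorem IsCompatible.add (h : IsCompatible O x) (hy : y ∈ orientationCone O) :
    IsCompatible O (x + y) :=
  ⟨fun a b hab => congrArg₂ (· + ·) (h.eq a b hab) (hy.1 a b hab),
    fun a b hab => add_lt_add_of_lt_of_le (h.lt a b hab) (hy.2 a b hab)⟩

/-- Adding an element of the cone preserves strict compatibility. If the cones agree, `x + y` is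
compatible with both orientations, and a labelling induces only one. -/
theorem IsCompatible.eq_of_orientationCone_eq (h : IsCompatible O x) (h' : IsCompatible O' y)
    (hO : orientationCone O = orientationCone O') : O = O' := by
  refine (h.add (y := y) ?_).unique (x := x + y) ?_
  · rw [hO]; exact h'.mem_orientationCone
  · rw [add_comm]; exact h'.add (by rw [← hO]; exact h.mem_orientationCone)

/-- The annihilator of the direction space of the face is the space of functionals constant on the
vertices of the oriented graph, whose dimension is the number of these vertices. -/
theorem IsCompatible.finrank_vectorSpan_maxFace (h : IsCompatible O x) (hF : F ∈ G.flats) :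
    Module.finrank ℝ (vectorSpan ℝ (G.maxFace x)) + Nat.card O.Vertex = n := by
  classical
  let _ : Fintype O.Vertex := Fintype.ofFinite _
  let Φ : (O.Vertex → ℝ) →ₗ[ℝ] Module.Dual ℝ (Fin n → ℝ) :=
    (dotProductEquiv ℝ (Fin n)).toLinearMap ∘ₗ LinearMap.funLeft ℝ ℝ (vertexOf O)
  have hinj : Function.Injective Φ := (dotProductEquiv ℝ (Fin n)).injective.comp
    (LinearMap.funLeft_injective_of_surjective ℝ ℝ _ (vertexOf_surjective O))
  obtain ⟨c, hc⟩ := exists_argmax G x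
  have hrange : Φ.range = (vectorSpan ℝ (G.maxFace x)).dualAnnihilator := by
    rw [← SetLike.coe_set_eq, vectorSpan_def, Submodule.coe_dualAnnihilator_span]
    ext φ
    constructor
    · rintro ⟨w, rfl⟩
      rintro _ ⟨p, hp, q, hq, rfl⟩
      have hconst : ∀ p ∈ G.maxFace x, Φ w p = ∑ U, (w ∘ vertexOf O) (c U) := fun p hp =>
        dotProduct_eq_of_mem_maxFace hc (fun U b hb => congrArg w
          (h.vertexOf_eq_of_mem_argmax hF U.2 hb (hc U))) hp
      exact (map_sub (Φ w) p q).trans (by rw [hconst p hp, hconst q hq, sub_self])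
    · intro hφ
      obtain ⟨y, rfl⟩ := (dotProductEquiv ℝ (Fin n)).surjective φ
      have hy : ∀ U ∈ G.edges, ∀ a ∈ argmax x U, ∀ b ∈ argmax x U, y a = y b := by
        intro U hU a ha b hb
        -- Two points of the face that differ only in the choice `a` or `b` on `U` have difference
        -- `e_a - e_b`.
        have := hφ (Set.vsub_mem_vsub
          (sum_single_mem_maxFace (update_mem_argmax hc (U := ⟨U, hU⟩) ha))
          (sum_single_mem_maxFace (update_mem_argmax hc (U := ⟨U, hU⟩) hb)))
        rw [SetLike.mem_coe, LinearMap.mem_ker, vsub_eq_sub, map_sub, dotProductEquiv_apply_apply,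
          dotProductEquiv_apply_apply, dotProduct_sum_single, dotProduct_sum_single,
          sum_update_sub, sub_eq_zero] at this
        exact this
      refine ⟨fun v => y (Function.surjInv (vertexOf_surjective O) v), ?_⟩
      refine congrArg (dotProductEquiv ℝ (Fin n)) (funext fun a => ?_)
      exact h.eq_of_eq_on_argmax hF hy (Function.surjInv_eq (vertexOf_surjective O) (vertexOf O a))
  have h1 := Subspace.finrank_add_finrank_dualAnnihilator_eq (vectorSpan ℝ (G.maxFace x))
  rw [← hrange, LinearMap.finrank_range_of_inj hinj, Module.finrank_fintype_fun_eq_card,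
    Module.finrank_fin_fun, ← Nat.card_eq_fintype_card] at h1
  exact h1

/-- The face of the polytope indexed by an acyclic orientation. -/
def faceOf (O : AcyclicOrientation (G.contract F)) : Set (Fin n → ℝ) :=
  G.maxFace (exists_isCompatible_real O.2).choose

theorem isIndexedBy_faceOf (hF : F ∈ G.flats) (O : AcyclicOrientation (G.contract F)) :
    IsIndexedBy (faceOf O) O.1 :=
  (exists_isCompatible_real O.2).choose_spec.isIndexedBy hF

theorem eq_faceOf (hF : F ∈ G.flats) {O : AcyclicOrientation (G.contract F)} {f : Set (Fin n → ℝ)}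
    (hf : IsIndexedBy f O.1) : f = faceOf O :=
  hf.1.eq_of_normalCone_eq (isIndexedBy_faceOf hF O).1
    (hf.2.trans (isIndexedBy_faceOf hF O).2.symm)

theorem faceOf_injective (hF : F ∈ G.flats) :
    Function.Injective (faceOf : AcyclicOrientation (G.contract F) → _) := by
  intro O O' h
  refine Subtype.ext ((exists_isCompatible_real O.2).choose_spec.eq_of_orientationCone_eq
    (exists_isCompatible_real O'.2).choose_spec ?_)
  rw [← (isIndexedBy_faceOf hF O).2, ← (isIndexedBy_faceOf hF O').2, h]

/-- A face with relative interior in the union shares a relative interior point with an indexed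
face, hence equals it. The relative interior is nonempty by convexity, so such a point exists. -/
theorem setOf_isFace_eq_range (hF : F ∈ G.flats) :
    {f | IsFace G.polytope f ∧ intrinsicInterior ℝ f ⊆ acyclicFaceUnion G F} =
      Set.range (faceOf : AcyclicOrientation (G.contract F) → _) := by
  ext f
  constructor
  · rintro ⟨hf, hsub⟩
    obtain ⟨p, hp⟩ := hf.1.intrinsicInterior (hf.2.convex (convex_polytope G))
    obtain ⟨O, g, hg, hpg⟩ := hsub hp
    exact ⟨O, by rw [hf.eq_of_mem_intrinsicInterior hg.1 hp hpg, eq_faceOf hF hg]⟩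
  · rintro ⟨O, rfl⟩
    exact ⟨(isIndexedBy_faceOf hF O).1, fun p hp => ⟨O, _, isIndexedBy_faceOf hF O, hp⟩⟩

theorem neg_one_pow_mul_antipodeCoeff (hF : F ∈ G.flats) :
    (-1) ^ n * G.antipodeCoeff F = eulerChar G.polytope (acyclicFaceUnion G F) := by
  rw [eulerChar, setOf_isFace_eq_range hF, finsum_mem_range (faceOf_injective hF),
    finsum_eq_sum_of_fintype, antipodeCoeff_eq_sum, Finset.mul_sum]
  refine Finset.sum_congr rfl fun O _ => ?_
  have h : Module.finrank ℝ (vectorSpan ℝ (faceOf O)) + Nat.card O.1.Vertex = n :=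
    (exists_isCompatible_real O.2).choose_spec.finrank_vectorSpan_maxFace hF
  have hpow : (-1 : ℤ) ^ n = (-1) ^ (Module.finrank ℝ (vectorSpan ℝ (faceOf O)) +
    Nat.card O.1.Vertex) := congrArg _ h.symm
  rw [hpow, pow_add, mul_assoc, ← mul_pow]
  simp

end Orientation

end SimpleHypergraph

end

theorem mainTheorem2 :
    ∃ S : HypergraphAlgebra →ₗ[ℚ] HypergraphAlgebra,
      IsAntipode ℚ S ∧ (∀ T : HypergraphAlgebra →ₗ[ℚ] HypergraphAlgebra, IsAntipode ℚ T → T = S) ∧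
      ∀ (n : ℕ) (G : SimpleHypergraph (Fin n)),
        S (HypergraphAlgebra.cls G) =
          ∑ F ∈ G.flats, (G.antipodeCoeff F : ℚ) • HypergraphAlgebra.cls F ∧
        ∀ F ∈ G.flats,
          (∀ O : SimpleHypergraph.AcyclicOrientation (G.contract F),
            ∃! f : Set (Fin n → ℝ), IsIndexedBy f O.1) ∧
          (-1) ^ n * G.antipodeCoeff F = eulerChar G.polytope (acyclicFaceUnion G F) := by
  have hS := HypergraphAlgebra.isAntipode_antipode
  refine ⟨HypergraphAlgebra.antipode, hS, fun T hT => HypergraphAlgebra.IsAntipode.unique hT hS,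
    fun n G => ⟨HypergraphAlgebra.IsAntipode.apply_cls hS G, fun F hF =>
      ⟨fun O => ⟨_, SimpleHypergraph.isIndexedBy_faceOf hF O, fun f hf =>
        SimpleHypergraph.eq_faceOf hF hf⟩, SimpleHypergraph.neg_one_pow_mul_antipodeCoeff hF⟩⟩⟩
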